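/- A Roman $\{3\}$-dominating function of a finite simple graph $G=(V,E)$ is a function $f:V\to\{0,1,2,3\}$ such that for every $u\in V$: if $f(u)=0$ then $\sum_{v\in N(u)}f(v)\ge 3$, and if $f(u)=1$ then $\sum_{v\in N(u)}f(v)\ge 2$. Its weight is $\sum_{u\in V}f(u)$, and $\gamma_{R3}(G)$ denotes the minimum weight of a Roman $\{3\}$-dominating function of $G$. A block of $G$ is a maximal connected subgraph of $G$ that has no cut-vertex, and $G$ is a block graph if each of its blocks is a complete graph. Theorem. The problem of computing $\gamma_{R3}(G)$ for block graphs $G$ is solvable in polynomial time, more precisely in time $O(n^3)$, where $n=|V|$. That is, there is a single algorithm (a program of a random access machine with words of $O(\log n)$ bits, on which every elementary instruction and every test takes one step) which, given the adjacency matrix of any block graph $G$ on the vertices $0,\dots,n-1$, halts after $O(n^3)$ steps, without overflow, with output $\gamma_{R3}(G)$. -/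

import Mathlib

/-! ### Roman {3}-domination -/

/-- A labelling `f : V → {0, 1, 2, 3}` is a Roman {3}-dominating function of `G` if the labels of
the neighbours of a vertex labelled `0` sum to at least `3`, and those of the neighbours of a vertex
labelled `1` sum to at least `2`. -/
def IsRoman3Dominating {V : Type*} [Fintype V] (G : SimpleGraph V) (f : V → Fin 4) : Prop :=
  open Classical in
  ∀ u : V,
    (f u = 0 → 3 ≤ ∑ v ∈ Finset.univ.filter (fun v => G.Adj u v), (f v : ℕ)) ∧
    (f u = 1 → 2 ≤ ∑ v ∈ Finset.univ.filter (fun v => G.Adj u v), (f v : ℕ))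

/-- The minimum weight `γ_R3(G)` of a Roman {3}-dominating function of `G`. -/
noncomputable def gammaR3 {V : Type*} [Fintype V] (G : SimpleGraph V) : ℕ :=
  sInf {w : ℕ | ∃ f : V → Fin 4, IsRoman3Dominating G f ∧ ∑ u, (f u : ℕ) = w}

/-- The infimum in `gammaR3` is an attained minimum. -/
theorem gammaR3_isLeast {V : Type*} [Fintype V] (G : SimpleGraph V) :
    IsLeast {w : ℕ | ∃ f : V → Fin 4, IsRoman3Dominating G f ∧ ∑ u, (f u : ℕ) = w}
      (gammaR3 G) := by
  have hne : {w : ℕ | ∃ f : V → Fin 4, IsRoman3Dominating G f ∧ ∑ u, (f u : ℕ) = w}.Nonempty :=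
    ⟨_, fun _ => 2, fun _ => ⟨fun h => absurd (show (2 : Fin 4) = 0 from h) (by decide),
      fun h => absurd (show (2 : Fin 4) = 1 from h) (by decide)⟩, rfl⟩
  exact ⟨Nat.sInf_mem hne, fun _ hw => Nat.sInf_le hw⟩

/-! ### Block graphs -/

/-- `u` is a cut-vertex of the finite graph `G` if `G - u` has more connected components than
`G`. -/
def IsCutVertex {V : Type*} [Finite V] (G : SimpleGraph V) (u : V) : Prop :=
  Nat.card G.ConnectedComponent < Nat.card (G.induce {u}ᶜ).ConnectedComponent

/-- A block of `G` is a maximal connected subgraph of `G` that has no cut-vertex (of itself). -/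
def IsBlock {V : Type*} [Finite V] (G : SimpleGraph V) (B : G.Subgraph) : Prop :=
  Maximal (fun H : G.Subgraph => H.Connected ∧ ∀ u : H.verts, ¬ IsCutVertex H.coe u) B

/-- A block graph is a (not necessarily connected) graph all of whose blocks are complete graphs. -/
def IsBlockGraph {V : Type*} [Finite V] (G : SimpleGraph V) : Prop :=
  ∀ B : G.Subgraph, IsBlock G B → B.coe = ⊤

/-! ### Word random access machines -/

namespace RAM

/-- A state of the machine: registers (a program mentions only finitely many of them) and a
memory that is addressed through the registers. -/
structure State where
  reg : ℕ → ℕ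
  mem : ℕ → ℕ

/-- Elementary instructions. In `load` and `store` the second register of the instruction (resp.
the first one) holds the memory address. -/
inductive Instr where
  /-- `R_d := c` -/
  | const (d c : ℕ)
  /-- `R_d := R_a` -/
  | move (d a : ℕ)
  /-- `R_d := R_a + R_b` -/
  | add (d a b : ℕ)
  /-- `R_d := max (R_a - R_b) 0` -/
  | sub (d a b : ℕ)
  /-- `R_d := R_a * R_b` -/
  | mul (d a b : ℕ)
  /-- `R_d := M[R_a]` -/
  | load (d a : ℕ)
  /-- `M[R_a] := R_b` -/
  | store (a b : ℕ)

/-- The value that an instruction writes (to a register, or to memory for `store`). -/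
def Instr.value (s : State) : Instr → ℕ
  | const _ c => c
  | move _ a => s.reg a
  | add _ a b => s.reg a + s.reg b
  | sub _ a b => s.reg a - s.reg b
  | mul _ a b => s.reg a * s.reg b
  | load _ a => s.mem (s.reg a)
  | store _ b => s.reg b

/-- The state after an instruction. -/
def Instr.apply (s : State) (i : Instr) : State :=
  match i with
  | const d _ | move d _ | add d _ _ | sub d _ _ | mul d _ _ | load d _ =>
      { s with reg := Function.update s.reg d (i.value s) }
  | store a _ => { s with mem := Function.update s.mem (s.reg a) (i.value s) }

/-- Tests on two registers. -/
inductive Test where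
  /-- `R_a < R_b` -/
  | lt (a b : ℕ)
  /-- `R_a = R_b` -/
  | eq (a b : ℕ)

/-- The truth value of a test in a state. -/
def Test.Holds (s : State) : Test → Prop
  | lt a b => s.reg a < s.reg b
  | eq a b => s.reg a = s.reg b

/-- Programs. A program is a finite object that does not depend on the input. -/
inductive Program where
  | skip
  | instr (i : Instr)
  | seq (p q : Program)
  | ite (b : Test) (p q : Program)
  | while (b : Test) (p : Program)

/-- `Exec W p s s' t`: on a machine whose words hold the numbers below `W`, the program `p` started
in state `s` halts in state `s'` after exactly `t` steps. Every elementary instruction and every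
evaluation of a test is one step. There is no rule for an instruction whose result does not fit
into a word, so `Exec` also says that no overflow occurs during the run. -/
inductive Exec (W : ℕ) : Program → State → State → ℕ → Prop where
  | skip (s : State) : Exec W .skip s s 0
  | instr (i : Instr) (s : State) (h : i.value s < W) : Exec W (.instr i) s (i.apply s) 1
  | seq {p q : Program} {s₁ s₂ s₃ : State} {t₁ t₂ : ℕ}
      (hp : Exec W p s₁ s₂ t₁) (hq : Exec W q s₂ s₃ t₂) : Exec W (.seq p q) s₁ s₃ (t₁ + t₂)
  | ite_true {b : Test} {p q : Program} {s₁ s₂ : State} {t : ℕ}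
      (hb : b.Holds s₁) (hp : Exec W p s₁ s₂ t) : Exec W (.ite b p q) s₁ s₂ (t + 1)
  | ite_false {b : Test} {p q : Program} {s₁ s₂ : State} {t : ℕ}
      (hb : ¬ b.Holds s₁) (hq : Exec W q s₁ s₂ t) : Exec W (.ite b p q) s₁ s₂ (t + 1)
  | while_true {b : Test} {p : Program} {s₁ s₂ s₃ : State} {t₁ t₂ : ℕ}
      (hb : b.Holds s₁) (hp : Exec W p s₁ s₂ t₁) (hw : Exec W (.while b p) s₂ s₃ t₂) :
      Exec W (.while b p) s₁ s₃ (t₁ + t₂ + 1)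
  | while_false {b : Test} {p : Program} {s : State}
      (hb : ¬ b.Holds s) : Exec W (.while b p) s s 1

/-- The initial state for the input graph `G` with vertices `0, …, n - 1`: register `0` holds `n`,
memory cells `0, …, n² - 1` hold the adjacency matrix row by row, and everything else is `0`. -/
noncomputable def input {n : ℕ} (G : SimpleGraph (Fin n)) : State :=
  open Classical in
  { reg := fun i => if i = 0 then n else 0
    mem := fun i => if ∃ u v : Fin n, G.Adj u v ∧ i = (u : ℕ) * n + (v : ℕ) then 1 else 0 }

end RAM

/-! Roman {3}-domination is turned into a cost minimisation. Every vertex carries a 4 × 4 table that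
prices its label together with the label sum of its closed neighbourhood, truncated at 3. A vertex
is dominated when its label is at least 2 or this sum is at least 3; an undominated vertex is priced
as if relabelled 2, and the minimum cost over all labellings is then `gammaR3 G`
(`isOptimum_gammaR3`).

Vertices are deleted one at a time while this minimum is preserved. In a block graph two neighbours
of `v` joined by a path avoiding `v` are adjacent, because the path and `v` lie in a common block
(`IsBlockGraph.adj_of_reflTransGen`). The property passes to induced subgraphs and forces an
isolated vertex, a pendant vertex or a pair of adjacent twins
(`exists_isolated_or_pendant_or_twins`). In each case the influence of the deleted vertex is
absorbed by the table of one neighbour, or by an additive constant, through a minimum over boundedly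
many labels (`IsOptimum.twin`, `IsOptimum.pendant`, `IsOptimum.isolated`). Truncation keeps the
tables finite, so a merge takes constant time.

For the running time, the program stores for each pair of vertices how many remaining vertices
distinguish them, and for each vertex its closed degree (`distCount`). These numbers reveal a vertex
to eliminate in constant time per pair, and a deletion changes each of them by at most one. A step
thus costs `O(n²)`, and `n` steps cost `O(n³)`. Table entries are capped at `2 * n + 3`, which is at
least `gammaR3 G`; the cap loses no optimum and prevents overflow. `Invariant` ties the memory to
the minimisation problem, and `runs_eliminate` preserves it. -/

namespace RAM

/-! ### Rules for reasoning about programs and their running time -/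

/-- `P` started in `s` halts without overflow, and the final state and the number of steps satisfy
`Post`. -/
def Runs (W : ℕ) (P : Program) (s : State) (Post : State → ℕ → Prop) : Prop :=
  ∃ s' t, Exec W P s s' t ∧ Post s' t

theorem Runs.mono {W : ℕ} {P : Program} {s : State} {Post Post' : State → ℕ → Prop}
    (h : Runs W P s Post) (hp : ∀ s' t, Post s' t → Post' s' t) : Runs W P s Post' := by
  obtain ⟨s', t, h1, h2⟩ := h
  exact ⟨s', t, h1, hp _ _ h2⟩

theorem Runs.skip {W : ℕ} {s : State} {Post : State → ℕ → Prop} (h : Post s 0) :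
    Runs W .skip s Post := ⟨s, 0, .skip s, h⟩

theorem Runs.instr {W : ℕ} {i : Instr} {s : State} {Post : State → ℕ → Prop}
    (hv : i.value s < W) (h : Post (i.apply s) 1) : Runs W (.instr i) s Post :=
  ⟨_, 1, .instr i s hv, h⟩

theorem Runs.seq {W : ℕ} {p q : Program} {s : State} {Post : State → ℕ → Prop}
    (h : Runs W p s fun s' t => Runs W q s' fun s'' t' => Post s'' (t + t')) :
    Runs W (.seq p q) s Post := by
  obtain ⟨s1, t1, h1, s2, t2, h2, h3⟩ := h
  exact ⟨s2, _, .seq h1 h2, h3⟩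

theorem Runs.ite {W : ℕ} {b : Test} {p q : Program} {s : State} {Post : State → ℕ → Prop}
    (hp : b.Holds s → Runs W p s fun s' t => Post s' (t + 1))
    (hq : ¬ b.Holds s → Runs W q s fun s' t => Post s' (t + 1)) :
    Runs W (.ite b p q) s Post := by
  by_cases hb : b.Holds s
  · obtain ⟨s1, t1, h1, h2⟩ := hp hb
    exact ⟨s1, _, .ite_true hb h1, h2⟩
  · obtain ⟨s1, t1, h1, h2⟩ := hq hb
    exact ⟨s1, _, .ite_false hb h1, h2⟩

/-- Straight-line programs. -/
def block : List Instr → Program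
  | [] => .skip
  | i :: l => .seq (.instr i) (block l)

/-- `for R_r := 0, …, R_b - 1`, where `R_1` holds the number `1`. -/
def forLoop (r b : ℕ) (body : Program) : Program :=
  .seq (.instr (.const r 0)) (.while (.lt r b) (.seq body (.instr (.add r r 1))))

/-- Each round pays for the body, the test and the increment, hence `T + 2`; the final 2 are the
initialisation and the failing test. `hstable` makes the invariant blind to the counter. The counter
ends at `N`, so `N < W` excludes overflow. -/
theorem Runs.of_forLoop {W r b N T : ℕ} {body : Program} {s : State} (Inv : ℕ → State → Prop)
    (hb : b < r) (h1 : 1 < r) (hN : s.reg b = N) (hone : s.reg 1 = 1) (hNW : N < W)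
    (hstable : ∀ i s v, Inv i s → Inv i ⟨Function.update s.reg r v, s.mem⟩)
    (h0 : Inv 0 s)
    (hbody : ∀ i < N, ∀ s' : State, (∀ q < r, s'.reg q = s.reg q) → s'.reg r = i → Inv i s' →
      Runs W body s' fun s'' t =>
        t ≤ T ∧ (∀ q < r + 1, s''.reg q = s'.reg q) ∧ Inv (i + 1) s'') :
    Runs W (forLoop r b body) s fun s' t =>
      t ≤ N * (T + 2) + 2 ∧ (∀ q < r, s'.reg q = s.reg q) ∧ Inv N s' := by
  -- Induction on the number `k` of rounds still to come.
  have key : ∀ k i, i + k = N → ∀ s' : State, (∀ q < r, s'.reg q = s.reg q) → s'.reg r = i →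
      Inv i s' → Runs W (.while (.lt r b) (.seq body (.instr (.add r r 1)))) s' fun s'' t =>
        t ≤ k * (T + 2) + 1 ∧ (∀ q < r, s''.reg q = s.reg q) ∧ Inv N s'' := by
    intro k
    induction k with
    | zero =>
      intro i hi s' hf hr hI
      refine ⟨s', 1, .while_false ?_, by omega, hf, ?_⟩
      · simp only [Test.Holds, hf b hb, hr]; omega
      · rwa [← hi]
    | succ k ih =>
      intro i hi s' hf hr hI
      obtain ⟨s1, t1, he, ht, hf1, hI1⟩ := hbody i (by omega) s' hf hr hI
      have hr1 : s1.reg r = i := by rw [hf1 r (by omega), hr]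
      have ho1 : s1.reg 1 = 1 := by rw [hf1 1 (by omega), hf 1 h1, hone]
      obtain ⟨s2, t2, he2, ht2, hf2, hI2⟩ := ih (i + 1) (by omega)
        ((Instr.add r r 1).apply s1)
        (by
          intro q hq
          simp only [Instr.apply]
          rw [Function.update_of_ne (by omega), hf1 q (by omega), hf q hq])
        (by simp [Instr.apply, Instr.value, hr1, ho1])
        (by
          simp only [Instr.apply]
          exact hstable _ _ _ hI1)
      refine ⟨s2, _, .while_true ?_ (.seq he (.instr _ s1 ?_)) he2, ?_, hf2, hI2⟩
      · simp only [Test.Holds, hf b hb, hr]; omega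
      · simp only [Instr.value, hr1, ho1]; omega
      · have : (k + 1) * (T + 2) = k * (T + 2) + (T + 2) := by ring
        omega
  have hW : 0 < W := by omega
  refine Runs.seq (Runs.instr hW ?_)
  refine (key N 0 (by omega) _ ?_ ?_ ?_).mono ?_
  · intro q hq
    simp only [Instr.apply]
    rw [Function.update_of_ne (by omega)]
  · simp [Instr.apply, Instr.value]
  · simp only [Instr.apply]
    exact hstable _ _ _ h0
  · rintro s' t ⟨ht, h⟩
    exact ⟨by omega, h⟩

/-- Two nested loops; the invariant is indexed by both counters. -/
theorem Runs.of_forLoop₂ {W r r' b b' N N' T : ℕ} {body : Program} {s : State}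
    (Inv : ℕ → ℕ → State → Prop)
    (hb : b < r) (h1 : 1 < r) (hr : r < r') (hb' : b' < r)
    (hN : s.reg b = N) (hN' : s.reg b' = N') (hone : s.reg 1 = 1) (hNW : N < W) (hNW' : N' < W)
    (hstable : ∀ i j s v, Inv i j s → Inv i j ⟨Function.update s.reg r v, s.mem⟩)
    (hstable' : ∀ i j s v, Inv i j s → Inv i j ⟨Function.update s.reg r' v, s.mem⟩)
    (h0 : Inv 0 0 s) (hrow : ∀ i < N, ∀ s, Inv i N' s → Inv (i + 1) 0 s)
    (hbody : ∀ i < N, ∀ j < N', ∀ s' : State, (∀ q < r, s'.reg q = s.reg q) → s'.reg r = i →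
      s'.reg r' = j → Inv i j s' →
      Runs W body s' fun s'' t =>
        t ≤ T ∧ (∀ q < r' + 1, s''.reg q = s'.reg q) ∧ Inv i (j + 1) s'') :
    Runs W (forLoop r b (forLoop r' b' body)) s fun s' t =>
      t ≤ N * (N' * (T + 2) + 4) + 2 ∧ (∀ q < r, s'.reg q = s.reg q) ∧ Inv N 0 s' := by
  refine (Runs.of_forLoop (T := N' * (T + 2) + 2) (fun i s => Inv i 0 s) hb h1 hN hone hNW
    (fun i s v h => hstable i 0 s v h) h0 ?_)
  intro i hi s1 hf hri hI
  refine (Runs.of_forLoop (T := T) (N := N') (fun j s => Inv i j s) (by omega) (by omega)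
    (by rw [hf b' hb', hN']) (by rw [hf 1 h1, hone]) hNW' (fun j s v h => hstable' i j s v h)
    hI ?_).mono ?_
  · intro j hj s2 hf2 hrj hI2
    exact hbody i hi j hj s2 (fun q hq => by rw [hf2 q (by omega), hf q hq])
      (by rw [hf2 r hr, hri]) hrj hI2
  · rintro s2 t ⟨ht, hf2, hI2⟩
    exact ⟨ht, fun q hq => hf2 q (by omega), hrow i hi _ hI2⟩

end RAM

/-! ### Connections in block graphs -/

-- Since `T` lies in the range of `φ`, a chain inside `T` lifts step by step. This serves subgraphs
-- and their vertex-deleted subgraphs, whose vertices are nested subtypes.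
open Relation in
theorem reachable_of_reflTransGen {V X : Type*} {G : SimpleGraph V} {K : SimpleGraph X}
    (φ : X → V) (hinj : Function.Injective φ) (hadj : ∀ a b, G.Adj (φ a) (φ b) → K.Adj a b)
    {T : Set V} (hT : ∀ v ∈ T, ∃ a, φ a = v) {a b : X}
    (h : ReflTransGen (fun p q => G.Adj p q ∧ p ∈ T ∧ q ∈ T) (φ a) (φ b)) : K.Reachable a b := by
  generalize hu : φ b = u at h
  induction h generalizing b with
  | refl => rw [hinj hu]
  | @tail p q h1 h2 ih =>
    obtain ⟨c, rfl⟩ := hT _ h2.2.1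
    subst hu
    exact (ih rfl).trans (hadj _ _ h2.1).reachable

namespace SimpleGraph

/-- A connected graph has at least one component and the rest has at most one, so the number cannot
grow. The rest may be empty. -/
theorem not_isCutVertex_of_preconnected {V : Type*} [Finite V] {G : SimpleGraph V} {u : V}
    (hG : G.Connected) (h : (G.induce {u}ᶜ).Preconnected) : ¬ IsCutVertex G u := by
  unfold IsCutVertex
  have h1 : 0 < Nat.card G.ConnectedComponent := by
    have := hG.nonempty
    have : Nonempty G.ConnectedComponent := ⟨G.connectedComponentMk hG.nonempty.some⟩
    exact Nat.card_pos
  have h2 : Nat.card (G.induce {u}ᶜ).ConnectedComponent ≤ 1 := by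
    have := h.subsingleton_connectedComponent
    exact Finite.card_le_one_iff_subsingleton.2 inferInstance
  omega

open Relation in
theorem Walk.reflTransGen_getVert {V : Type*} {G : SimpleGraph V} {x y : V} (p : G.Walk x y)
    {T : Set V} {i : ℕ} : ∀ j, i ≤ j → j ≤ p.length → (∀ m, i ≤ m → m ≤ j → p.getVert m ∈ T) →
      ReflTransGen (fun a b => G.Adj a b ∧ a ∈ T ∧ b ∈ T) (p.getVert i) (p.getVert j) := by
  intro j hij
  induction j, hij using Nat.le_induction with
  | base => intros; exact .refl
  | succ j hij ih =>
    intro hj hT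
    exact (ih (by omega) fun m h1 h2 => hT m h1 (by omega)).tail
      ⟨p.adj_getVert_succ (by omega), hT j hij (by omega), hT (j + 1) (by omega) le_rfl⟩

end SimpleGraph

open Relation in
theorem reflTransGen_symm_of_adj {V : Type*} {G : SimpleGraph V} {T : Set V} {a b : V}
    (h : ReflTransGen (fun p q => G.Adj p q ∧ p ∈ T ∧ q ∈ T) a b) :
    ReflTransGen (fun p q => G.Adj p q ∧ p ∈ T ∧ q ∈ T) b a :=
  have : Std.Symm (fun p q => G.Adj p q ∧ p ∈ T ∧ q ∈ T) :=
    ⟨fun _ _ h => ⟨h.1.symm, h.2.2, h.2.1⟩⟩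
  ReflTransGen.stdSymm.symm _ _ h

open Relation in
/-- In a block graph, two neighbours of `v` that are connected in `G - v` are adjacent. -/
theorem IsBlockGraph.adj_of_reflTransGen {V : Type*} [Finite V] {G : SimpleGraph V}
    (hG : IsBlockGraph G) {v x y : V} (hx : G.Adj v x) (hy : G.Adj v y)
    (hxy : ReflTransGen (fun a b => G.Adj a b ∧ a ≠ v ∧ b ≠ v) x y) (hne : x ≠ y) :
    G.Adj x y := by
  classical
  have hw : ∃ p : G.Walk x y, v ∉ p.support := by
    clear hy hne
    induction hxy with
    | refl => exact ⟨.nil, by simpa using hx.ne⟩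
    | tail h1 h2 ih =>
      obtain ⟨p, hp⟩ := ih
      refine ⟨p.concat h2.1, ?_⟩
      rw [SimpleGraph.Walk.support_concat]
      simp [hp, h2.2.2.symm]
  obtain ⟨p, hpath, hv⟩ : ∃ p : G.Walk x y, p.IsPath ∧ v ∉ p.support := by
    obtain ⟨p, hp⟩ := hw
    exact ⟨p.bypass, p.bypass_isPath, fun h => hp (p.support_bypass_subset_support h)⟩
  -- Together with `v` the path closes up to a cycle, whose vertex set is `S`. A cycle has no
  -- cut-vertex.
  set S : Set V := {w | w = v ∨ w ∈ p.support} with hS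
  have hmem : ∀ m, p.getVert m ∈ S := fun m => Or.inr (p.getVert_mem_support m)
  have hvm : ∀ m, p.getVert m ≠ v := fun m h => hv (h ▸ p.getVert_mem_support m)
  have hxS : x ∈ S := Or.inr p.start_mem_support
  have hyS : y ∈ S := Or.inr p.end_mem_support
  have hvS : v ∈ S := Or.inl rfl
  -- after the removal of one vertex `u` everything is still connected
  have hcon : ∀ T ⊆ S, v ∈ T → ∀ u, (∀ w ∈ S, w ≠ u → w ∈ T) → ∀ z ∈ T, z = u ∨
      ReflTransGen (fun a b => G.Adj a b ∧ a ∈ T ∧ b ∈ T) v z := by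
    intro T hTS hvT u hT z hz
    by_cases hzu : z = u
    · exact Or.inl hzu
    refine Or.inr ?_
    rcases hTS hz with rfl | hzp
    · exact .refl
    obtain ⟨i, rfl, hi⟩ := (SimpleGraph.Walk.mem_support_iff_exists_getVert).1 hzp
    -- From `v` the vertex `z` is reached through `x`, or backwards from `y` if `u` blocks the first
    -- way. A path meets `u` only once, so it cannot block both.
    by_cases hu : ∃ m ≤ i, p.getVert m = u
    · obtain ⟨m, hmi, rfl⟩ := hu
      have hmi' : m ≠ i := fun h => hzu (by rw [h])
      have hall : ∀ m', i ≤ m' → m' ≤ p.length → p.getVert m' ∈ T := fun m' h1 h2 =>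
        hT _ (hmem _) fun h => by
          have := hpath.getVert_injOn (by simpa using h2) (by simp; omega) h
          omega
      have h1 := p.reflTransGen_getVert (T := T) p.length hi le_rfl hall
      refine ReflTransGen.head ⟨?_, hvT, ?_⟩ (reflTransGen_symm_of_adj h1)
      · simpa using hy
      · exact hall _ hi le_rfl
    · push Not at hu
      have hall : ∀ m', 0 ≤ m' → m' ≤ i → p.getVert m' ∈ T := fun m' _ h2 =>
        hT _ (hmem _) (hu m' h2)
      have h1 := p.reflTransGen_getVert (T := T) i (Nat.zero_le _) hi hall
      refine ReflTransGen.head ⟨?_, hvT, ?_⟩ h1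
      · simpa using hx
      · exact hall _ le_rfl (Nat.zero_le _)
  -- Deleting `v` from the cycle leaves the path.
  have hcon' : ∀ z ∈ S \ {v},
      ReflTransGen (fun a b => G.Adj a b ∧ a ∈ S \ {v} ∧ b ∈ S \ {v}) x z := by
    rintro z ⟨hz | hz, hzv⟩
    · exact absurd hz hzv
    obtain ⟨i, rfl, hi⟩ := (SimpleGraph.Walk.mem_support_iff_exists_getVert).1 hz
    have h1 := p.reflTransGen_getVert (T := S \ {v}) i (Nat.zero_le _) hi
      fun m _ _ => ⟨hmem m, hvm m⟩
    simpa using h1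
  let H : G.Subgraph := (⊤ : G.Subgraph).induce S
  have hHv : H.verts = S := rfl
  have hHadj : ∀ a b : H.verts, G.Adj a b → H.coe.Adj a b := fun a b h => by
    simp only [SimpleGraph.Subgraph.coe_adj]
    exact ⟨a.2, b.2, h⟩
  have hHcon : H.coe.Connected := by
    have hb : ∀ z : H.verts, H.coe.Reachable ⟨v, hvS⟩ z := fun z => by
      by_cases hzx : (z : V) = v
      · exact (Subtype.ext hzx.symm : (⟨v, hvS⟩ : H.verts) = z) ▸ SimpleGraph.Reachable.refl _
      refine reachable_of_reflTransGen (G := G) (T := S) Subtype.val Subtype.val_injective hHadj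
        (fun w hw => ⟨⟨w, hw⟩, rfl⟩) ?_
      have hx' : ReflTransGen (fun a b => G.Adj a b ∧ a ∈ S ∧ b ∈ S) x z :=
        ReflTransGen.mono (fun _ _ h => ⟨h.1, h.2.1.1, h.2.2.1⟩) _ _ (hcon' z ⟨z.2, hzx⟩)
      exact ReflTransGen.head ⟨hx, hvS, hxS⟩ hx'
    have : Nonempty H.verts := ⟨⟨v, hvS⟩⟩
    exact ⟨fun a b => (hb a).symm.trans (hb b)⟩
  have hHcut : ∀ u : H.verts, ¬ IsCutVertex H.coe u := by
    intro u
    refine SimpleGraph.not_isCutVertex_of_preconnected hHcon ?_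
    have hred : ∀ c ∈ S \ {(u : V)}, (∀ z ∈ S \ {(u : V)}, ReflTransGen
        (fun a b => G.Adj a b ∧ a ∈ S \ {(u : V)} ∧ b ∈ S \ {(u : V)}) c z) →
        (H.coe.induce {u}ᶜ).Preconnected := by
      intro c hc hz
      have hb : ∀ z : ({u}ᶜ : Set H.verts), (H.coe.induce {u}ᶜ).Reachable
          ⟨⟨c, hc.1⟩, fun h => hc.2 (congrArg Subtype.val h)⟩ z := fun z => by
        refine reachable_of_reflTransGen (G := G) (T := S \ {(u : V)}) (fun z => z.1.1)
          (fun a b h => Subtype.ext (Subtype.ext h)) (fun a b h => hHadj _ _ h)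
          (fun w hw => ⟨⟨⟨w, hw.1⟩, fun h => hw.2
            (show w = u from congrArg (fun a : H.verts => (a : V)) (Set.mem_singleton_iff.1 h))⟩, rfl⟩) ?_
        exact hz _ ⟨z.1.2, fun h => z.2 (Subtype.ext h)⟩
      exact fun a b => (hb a).symm.trans (hb b)
    by_cases huv : (u : V) = v
    · exact hred x ⟨hxS, by rw [huv]; exact hx.ne'⟩ (by rw [huv]; exact hcon')
    · refine hred v ⟨hvS, fun h => huv h.symm⟩ fun z hz => ?_
      exact (hcon (S \ {(u : V)}) Set.sdiff_subset ⟨hvS, fun h => huv h.symm⟩ u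
        (fun w hw hwu => ⟨hw, hwu⟩) z hz).resolve_left hz.2
  -- The cycle extends to a block, and this block is complete, so it contains the edge between `x`
  -- and `y`.
  obtain ⟨B, hHB, hB⟩ := Set.Finite.exists_le_maximal
    (Set.toFinite {H : G.Subgraph | H.Connected ∧ ∀ u : H.verts, ¬ IsCutVertex H.coe u})
    (a := H) ⟨⟨hHcon⟩, hHcut⟩
  have hBtop := hG B hB
  have : B.coe.Adj ⟨x, hHB.1 hxS⟩ ⟨y, hHB.1 hyS⟩ := by
    rw [hBtop]
    simpa using hne
  exact B.adj_sub this

/-! ### Existence of a vertex to eliminate -/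

open Relation in
/-- If two neighbours of a vertex `v` in `U` that are connected in `G[U] - v` are always adjacent,
then `G[U]` has an isolated vertex, a pendant vertex or a pair of adjacent twins. -/
theorem exists_isolated_or_pendant_or_twins {V : Type*} [DecidableEq V] {G : SimpleGraph V}
    {U : Finset V} (hU : U.Nonempty)
    (hK : ∀ v x y, G.Adj v x → G.Adj v y →
      ReflTransGen (fun a b => G.Adj a b ∧ a ∈ (U : Set V) \ {v} ∧ b ∈ (U : Set V) \ {v}) x y →
      x ≠ y → G.Adj x y) :
    (∃ x ∈ U, ∀ w ∈ U, ¬ G.Adj x w) ∨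
    (∃ x ∈ U, ∃ y ∈ U, G.Adj x y ∧ ∀ w ∈ U, G.Adj x w → w = y) ∨
    (∃ x ∈ U, ∃ y ∈ U, G.Adj x y ∧ ∀ w ∈ U, w ≠ x → w ≠ y → (G.Adj x w ↔ G.Adj y w)) := by
  classical
  by_cases hE : ∃ p : V × V, p.1 ∈ U ∧ p.2 ∈ U ∧ G.Adj p.1 p.2
  swap
  · push Not at hE
    obtain ⟨x, hx⟩ := hU
    exact Or.inl ⟨x, hx, fun w hw => hE (x, w) hx hw⟩
  -- For an edge `(v, z)`, `C (v, z)` is the component of `z` in `G[U] - v`. An edge with the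
  -- smallest such component points into a leaf block, attached at `v`.
  let C : V × V → Finset V := fun p => U.filter fun y =>
    ReflTransGen (fun a b => G.Adj a b ∧ a ∈ (U : Set V) \ {p.1} ∧ b ∈ (U : Set V) \ {p.1}) p.2 y
  have hC : ∀ p y, y ∈ C p ↔ y ∈ U ∧ ReflTransGen (fun a b => G.Adj a b ∧
      a ∈ (U : Set V) \ {p.1} ∧ b ∈ (U : Set V) \ {p.1}) p.2 y := fun p y => by simp [C]
  obtain ⟨⟨v, z⟩, ⟨hv, hz, hvz⟩, hmin⟩ := exists_minimalFor_of_wellFoundedLT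
    (fun p : V × V => p.1 ∈ U ∧ p.2 ∈ U ∧ G.Adj p.1 p.2) (fun p => (C p).card) hE
  have hne : ∀ a b y, G.Adj a b → y ∈ C (a, b) → y ≠ a := by
    intro a b y hab hy
    rcases (ReflTransGen.cases_tail_iff _ _ _).1 ((hC _ _).1 hy).2 with rfl | ⟨d, -, -, -, h⟩
    · exact hab.ne'
    · exact h.2
  have hstep : ∀ a b y w, y ∈ C (a, b) → w ∈ U → w ≠ a → y ≠ a → G.Adj y w → w ∈ C (a, b) :=
    fun a b y w hy hw hwa hya h =>
      (hC _ _).2 ⟨hw, ((hC _ _).1 hy).2.tail ⟨h, ⟨((hC _ _).1 hy).1, hya⟩, ⟨hw, hwa⟩⟩⟩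
  have hzC : z ∈ C (v, z) := (hC _ _).2 ⟨hz, .refl⟩
  have hadj : ∀ y ∈ C (v, z), G.Adj v y := by
    intro y hy
    have hy' := ((hC _ _).1 hy).2
    clear hy
    induction hy' with
    | refl => exact hvz
    | @tail b c h1 h2 ih =>
      -- Here `b` is adjacent to `v` but the next vertex `c` is not. Then `v` is not in `C (b, c)`,
      -- since `c` and `v` are both neighbours of `b`. So `C (b, c)` stays inside `C (v, z)` and
      -- misses `b`, against minimality.
      by_contra hn
      obtain ⟨hbc, ⟨hbU, hbv⟩, ⟨hcU, hcv⟩⟩ := h2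
      have hbC : b ∈ C (v, z) := (hC _ _).2 ⟨hbU, h1⟩
      have hcC : c ∈ C (v, z) := hstep _ _ _ _ hbC hcU hcv hbv hbc
      have hvn : v ∉ C (b, c) := fun hvC =>
        hn (hK b c v hbc ih.symm ((hC _ _).1 hvC).2 hcv).symm
      have hsub : C (b, c) ⊆ C (v, z) := by
        intro y hy
        have hyR := ((hC _ _).1 hy).2
        clear hy
        induction hyR with
        | refl => exact hcC
        | @tail d e h3 h4 ih2 =>
          have heC : e ∈ C (b, c) := (hC _ _).2 ⟨h4.2.2.1, h3.tail h4⟩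
          exact hstep _ _ _ _ ih2 h4.2.2.1 (fun h => hvn (h ▸ heC)) (hne v z d hvz ih2) h4.1
      have hlt : (C (b, c)).card < (C (v, z)).card :=
        Finset.card_lt_card ⟨hsub, fun h => hne b c b hbc (h hbC) rfl⟩
      exact absurd (hmin (j := (b, c)) ⟨hbU, hcU, hbc⟩ hlt.le) (not_le.2 hlt)
  have hnb : ∀ y ∈ C (v, z), ∀ w ∈ U, G.Adj y w → w = v ∨ w ∈ C (v, z) := fun y hy w hw h => by
    by_cases hwv : w = v
    · exact Or.inl hwv
    · exact Or.inr (hstep _ _ _ _ hy hw hwv (hne v z y hvz hy) h)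
  have hcl : ∀ y ∈ C (v, z), ∀ w ∈ C (v, z), y ≠ w → G.Adj y w := fun y hy w hw hyw =>
    hK v y w (hadj y hy) (hadj w hw)
      ((reflTransGen_symm_of_adj ((hC _ _).1 hy).2).trans ((hC _ _).1 hw).2) hyw
  -- Now `C (v, z)` is a clique, completely joined to `v` and without other neighbours in `U`. Two
  -- of its vertices are twins; a single one is pendant at `v`.
  refine Or.inr ?_
  by_cases hone : ∃ y ∈ C (v, z), y ≠ z
  · obtain ⟨y, hy, hyz⟩ := hone
    refine Or.inr ⟨z, hz, y, ((hC _ _).1 hy).1, hcl z hzC y hy hyz.symm, fun w hw hwz hwy => ?_⟩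
    have hside : ∀ a ∈ C (v, z), ∀ b ∈ C (v, z), w ≠ b → G.Adj a w → G.Adj b w := by
      intro a ha b hb hwb h
      rcases hnb a ha w hw h with rfl | hwC
      · exact (hadj b hb).symm
      · exact hcl b hb w hwC hwb.symm
    exact ⟨hside z hzC y hy hwy, hside y hy z hzC hwz⟩
  · push Not at hone
    refine Or.inl ⟨z, hz, v, hv, hvz.symm, fun w hw h => ?_⟩
    rcases hnb z hzC w hw h with rfl | hwC
    · rfl
    · exact absurd (hone w hwC) h.ne'

/-! ### Elimination of vertices in a cost minimisation problem -/

open Classical in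
/-- The sum of the labels `b` over the closed neighbourhood of `u` within `U`, where `c` is the
closed adjacency relation. -/
noncomputable def closedSum {V : Type*} (c : V → V → Prop) (U : Finset V) (b : V → ℕ) (u : V) : ℕ :=
  ∑ w ∈ U, if c u w then b w else 0

/-- The cost of the labelling `b` of `U`: a vertex `u` pays `A u p q` if its label is `p` and the
labels of its closed neighbourhood sum to `q`, where `3` stands for all larger numbers. -/
noncomputable def tableCost {V : Type*} (c : V → V → Prop) (U : Finset V) (A : V → ℕ → ℕ → ℕ)
    (b : V → ℕ) : ℕ :=
  ∑ u ∈ U, A u (b u) (min (closedSum c U b u) 3)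

/-- `γ` is the minimum of `a + tableCost c U A b` over all labellings `b` with labels at most
`3`. -/
def IsOptimum {V : Type*} (c : V → V → Prop) (U : Finset V) (A : V → ℕ → ℕ → ℕ) (a γ : ℕ) : Prop :=
  (∃ b : V → ℕ, (∀ u, b u ≤ 3) ∧ a + tableCost c U A b ≤ γ) ∧
    ∀ b : V → ℕ, (∀ u, b u ≤ 3) → γ ≤ a + tableCost c U A b

theorem closedSum_congr {V : Type*} {c : V → V → Prop} {U : Finset V}
    {b b' : V → ℕ} (h : ∀ w ∈ U, b w = b' w) (u : V) :
    closedSum c U b u = closedSum c U b' u :=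
  Finset.sum_congr rfl fun w hw => by rw [h w hw]

section Elimination

variable {V : Type*} [DecidableEq V] {c : V → V → Prop} {U : Finset V} {A A' : V → ℕ → ℕ → ℕ}
  {a a' γ B : ℕ} {x y : V}

open Classical in
theorem closedSum_erase (hx : x ∈ U) (b : V → ℕ) (u : V) :
    closedSum c U b u = closedSum c (U.erase x) b u + if c u x then b x else 0 := by
  unfold closedSum
  rw [Finset.sum_erase_add _ _ hx]

-- Truncation commutes with addition: `min (s + min t 3) 3 = min (s + t) 3`. A vertex that sees both
-- or neither of `x` and `y` cannot tell them from one vertex with the truncated joint label.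
open Classical in
theorem min_closedSum_twin (hx : x ∈ U) (hy : y ∈ U) (hxy : x ≠ y) {u : V}
    (hu : c u x ↔ c u y) {b b' : V → ℕ} (hby : b' y = min (b x + b y) 3)
    (hb : ∀ w ∈ U, w ≠ x → w ≠ y → b' w = b w) :
    min (closedSum c (U.erase x) b' u) 3 = min (closedSum c U b u) 3 := by
  have hy' : y ∈ U.erase x := Finset.mem_erase.2 ⟨hxy.symm, hy⟩
  rw [closedSum_erase hx, closedSum_erase hy', closedSum_erase hy' b, hby,
    closedSum_congr (b := b') (b' := b)]
  · by_cases h : c u y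
    · simp only [h, hu.2 h, if_true]
      omega
    · simp only [h, mt hu.1 h, if_false]
  · intro w hw
    simp only [Finset.mem_erase] at hw
    exact hb w hw.2.2 hw.2.1 hw.1

/-- Twins see the same closed neighbourhood, so both tables are read in one column `k`. The cost `R`
of the other vertices is unaffected by the merge. -/
theorem tableCost_twin (hx : x ∈ U) (hy : y ∈ U) (hxy : x ≠ y)
    (hc : ∀ u ∈ U, c u x ↔ c u y) (hc' : ∀ u ∈ U, c x u ↔ c y u)
    (hA : ∀ u ∈ U, u ≠ x → u ≠ y → ∀ p ≤ 3, ∀ q ≤ 3, A' u p q = A u p q)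
    {b b' : V → ℕ} (hb3 : ∀ u, b u ≤ 3) (hby : b' y = min (b x + b y) 3)
    (hb : ∀ w ∈ U, w ≠ x → w ≠ y → b' w = b w) :
    ∃ R k, k = min (closedSum c (U.erase x) b' y) 3 ∧
      tableCost c U A b = R + (A x (b x) k + A y (b y) k) ∧
      tableCost c (U.erase x) A' b' = R + A' y (b' y) k := by
  have hy' : y ∈ U.erase x := Finset.mem_erase.2 ⟨hxy.symm, hy⟩
  refine ⟨∑ u ∈ (U.erase x).erase y, A u (b u) (min (closedSum c U b u) 3), _, rfl, ?_, ?_⟩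
  · unfold tableCost
    rw [← Finset.sum_erase_add _ _ hx, ← Finset.sum_erase_add _ _ hy',
      min_closedSum_twin hx hy hxy (hc y hy) hby hb]
    have : closedSum c U b x = closedSum c U b y :=
      Finset.sum_congr rfl fun w hw => by
        have := hc' w hw
        by_cases h : c y w <;> simp [h, this]
    rw [this]
    ring
  · unfold tableCost
    rw [← Finset.sum_erase_add _ _ hy']
    congr 1
    refine Finset.sum_congr rfl fun u hu => ?_
    simp only [Finset.mem_erase] at hu
    rw [min_closedSum_twin hx hy hxy (hc u hu.2.2) hby hb, hb u hu.2.2 hu.2.1 hu.1,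
      hA u hu.2.2 hu.2.1 hu.1 _ (hb3 u) _ (min_le_right _ _)]

/-- Merging a vertex `x` into an adjacent twin `y`. -/
theorem IsOptimum.twin (h : IsOptimum c U A a γ) (hγ : γ ≤ B)
    (hx : x ∈ U) (hy : y ∈ U) (hxy : x ≠ y)
    (hc : ∀ u ∈ U, c u x ↔ c u y) (hc' : ∀ u ∈ U, c x u ↔ c y u)
    (hA : ∀ u ∈ U, u ≠ x → u ≠ y → ∀ p ≤ 3, ∀ q ≤ 3, A' u p q = A u p q)
    (hle : ∀ i ≤ 3, ∀ j ≤ 3, ∀ k ≤ 3, A' y (min (i + j) 3) k ≤ A x j k + A y i k)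
    (hge : ∀ p ≤ 3, ∀ k ≤ 3, B ≤ A' y p k ∨ ∃ i ≤ 3, ∃ j ≤ 3, min (i + j) 3 = p ∧
      A x j k + A y i k ≤ A' y p k) :
    IsOptimum c (U.erase x) A' a γ := by
  obtain ⟨⟨b, hb3, hb⟩, hopt⟩ := h
  -- A labelling before the merge yields one after it: `y` receives the truncated joint label.
  refine ⟨⟨Function.update b y (min (b x + b y) 3), fun u => ?_, ?_⟩, fun b' hb' => ?_⟩
  · rcases eq_or_ne u y with rfl | hu
    · simp
    · rw [Function.update_of_ne hu]; exact hb3 u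
  · obtain ⟨R, k, hk, h1, h2⟩ := tableCost_twin hx hy hxy hc hc' hA hb3
      (b' := Function.update b y (min (b x + b y) 3)) (by simp)
      (fun w _ _ hw => Function.update_of_ne hw _ _)
    have := hle (b y) (hb3 y) (b x) (hb3 x) k (by omega)
    rw [Function.update_self] at h2
    rw [add_comm (b y)] at this
    omega
  -- Conversely, either the entry used at `y` is at least `B` and alone pays for `γ`, or the label
  -- of `y` splits into labels of `y` and `x` whose joint price does not exceed the entry.
  · have hy' : y ∈ U.erase x := Finset.mem_erase.2 ⟨hxy.symm, hy⟩
    rcases hge (b' y) (hb' y) (min (closedSum c (U.erase x) b' y) 3) (min_le_right _ _) with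
      hB | ⟨i, hi, j, hj, hij, hle'⟩
    · have : A' y (b' y) (min (closedSum c (U.erase x) b' y) 3) ≤
          tableCost c (U.erase x) A' b' :=
        Finset.single_le_sum (f := fun u => A' u (b' u) (min (closedSum c (U.erase x) b' u) 3))
          (fun _ _ => Nat.zero_le _) hy'
      omega
    · set b : V → ℕ := Function.update (Function.update b' y i) x j with hbdef
      have hbx : b x = j := by simp [hbdef]
      have hby : b y = i := by simp [hbdef, Function.update_of_ne hxy.symm]
      have hbo : ∀ w, w ≠ x → w ≠ y → b w = b' w := fun w h1 h2 => by
        simp [hbdef, Function.update_of_ne h1, Function.update_of_ne h2]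
      have hb3 : ∀ u, b u ≤ 3 := fun u => by
        rcases eq_or_ne u x with rfl | hux
        · omega
        rcases eq_or_ne u y with rfl | huy
        · omega
        rw [hbo u hux huy]; exact hb' u
      obtain ⟨R, k, hk, h1, h2⟩ := tableCost_twin hx hy hxy hc hc' hA hb3
        (b' := b') (by rw [hbx, hby, add_comm, hij]) (fun w _ h1 h2 => (hbo w h1 h2).symm)
      have := hopt b hb3
      rw [← hk] at hle'
      rw [hbx, hby] at h1
      omega

/-- A pendant `x` sees only itself and `y`, and only these two see `x`. After the merge the column
`k` of `y` no longer counts `x`, so the old table of `y` has to be read in the shifted column `min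
(k + b x) 3`. -/
theorem tableCost_pendant (hx : x ∈ U) (hy : y ∈ U) (hxy : x ≠ y)
    (hc : ∀ u ∈ U, c u x ↔ u = x ∨ u = y) (hc' : ∀ u ∈ U, c x u ↔ u = x ∨ u = y)
    (hA : ∀ u ∈ U, u ≠ x → u ≠ y → ∀ p ≤ 3, ∀ q ≤ 3, A' u p q = A u p q)
    {b b' : V → ℕ} (hb3 : ∀ u, b u ≤ 3) (hb : ∀ w ∈ U, w ≠ x → b' w = b w) :
    ∃ R k, k = min (closedSum c (U.erase x) b' y) 3 ∧
      tableCost c U A b =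
        R + (A x (b x) (min (b y + b x) 3) + A y (b y) (min (k + b x) 3)) ∧
      tableCost c (U.erase x) A' b' = R + A' y (b y) k := by
  classical
  have hy' : y ∈ U.erase x := Finset.mem_erase.2 ⟨hxy.symm, hy⟩
  have hbb : ∀ u, closedSum c (U.erase x) b' u = closedSum c (U.erase x) b u := fun u =>
    closedSum_congr (fun w hw => hb w (Finset.mem_erase.1 hw).2 (Finset.mem_erase.1 hw).1) u
  refine ⟨∑ u ∈ (U.erase x).erase y, A u (b u) (min (closedSum c U b u) 3), _, rfl, ?_, ?_⟩
  · unfold tableCost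
    rw [← Finset.sum_erase_add _ _ hx, ← Finset.sum_erase_add _ _ hy', hbb]
    have h1 : closedSum c U b x = b y + b x := by
      rw [closedSum_erase hx, closedSum_erase hy', if_pos ((hc' y hy).2 (Or.inr rfl)),
        if_pos ((hc' x hx).2 (Or.inl rfl))]
      have : closedSum c ((U.erase x).erase y) b x = 0 :=
        Finset.sum_eq_zero fun w hw => by
          simp only [Finset.mem_erase] at hw
          rw [if_neg fun h => ((hc' w hw.2.2).1 h).elim hw.2.1 hw.1]
      omega
    have h2 : closedSum c U b y = closedSum c (U.erase x) b y + b x := by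
      rw [closedSum_erase hx, if_pos ((hc y hy).2 (Or.inr rfl))]
    have h3 : min (min (closedSum c (U.erase x) b y) 3 + b x) 3 =
        min (closedSum c (U.erase x) b y + b x) 3 := by omega
    rw [h1, h2, h3]
    ring
  · unfold tableCost
    rw [← Finset.sum_erase_add _ _ hy', hb y hy hxy.symm]
    congr 1
    refine Finset.sum_congr rfl fun u hu => ?_
    simp only [Finset.mem_erase] at hu
    rw [hbb, closedSum_erase hx, if_neg fun h => ((hc u hu.2.2).1 h).elim hu.2.1 hu.1, add_zero,
      hb u hu.2.2 hu.2.1, hA u hu.2.2 hu.2.1 hu.1 _ (hb3 u) _ (min_le_right _ _)]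

/-- Merging a pendant vertex `x` into its neighbour `y`. -/
theorem IsOptimum.pendant (h : IsOptimum c U A a γ) (hγ : γ ≤ B)
    (hx : x ∈ U) (hy : y ∈ U) (hxy : x ≠ y)
    (hc : ∀ u ∈ U, c u x ↔ u = x ∨ u = y) (hc' : ∀ u ∈ U, c x u ↔ u = x ∨ u = y)
    (hA : ∀ u ∈ U, u ≠ x → u ≠ y → ∀ p ≤ 3, ∀ q ≤ 3, A' u p q = A u p q)
    (hle : ∀ i ≤ 3, ∀ j ≤ 3, ∀ k ≤ 3,
      A' y i k ≤ A x j (min (i + j) 3) + A y i (min (k + j) 3))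
    (hge : ∀ i ≤ 3, ∀ k ≤ 3, B ≤ A' y i k ∨ ∃ j ≤ 3,
      A x j (min (i + j) 3) + A y i (min (k + j) 3) ≤ A' y i k) :
    IsOptimum c (U.erase x) A' a γ := by
  obtain ⟨⟨b, hb3, hb⟩, hopt⟩ := h
  refine ⟨⟨b, hb3, ?_⟩, fun b' hb' => ?_⟩
  · obtain ⟨R, k, hk, h1, h2⟩ := tableCost_pendant hx hy hxy hc hc' hA hb3
      (b' := b) (fun _ _ _ => rfl)
    have := hle (b y) (hb3 y) (b x) (hb3 x) k (by omega)
    omega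
  · have hy' : y ∈ U.erase x := Finset.mem_erase.2 ⟨hxy.symm, hy⟩
    rcases hge (b' y) (hb' y) (min (closedSum c (U.erase x) b' y) 3) (min_le_right _ _) with
      hB | ⟨j, hj, hle'⟩
    · have : A' y (b' y) (min (closedSum c (U.erase x) b' y) 3) ≤
          tableCost c (U.erase x) A' b' :=
        Finset.single_le_sum (f := fun u => A' u (b' u) (min (closedSum c (U.erase x) b' u) 3))
          (fun _ _ => Nat.zero_le _) hy'
      omega
    · have hb3 : ∀ u, Function.update b' x j u ≤ 3 := fun u => by
        rcases eq_or_ne u x with rfl | hux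
        · simpa using hj
        · rw [Function.update_of_ne hux]; exact hb' u
      obtain ⟨R, k, hk, h1, h2⟩ := tableCost_pendant hx hy hxy hc hc' hA hb3
        (b' := b') (fun w _ h => (Function.update_of_ne h _ _).symm)
      have := hopt _ hb3
      rw [Function.update_self, Function.update_of_ne hxy.symm] at h1
      rw [Function.update_of_ne hxy.symm] at h2
      rw [← hk] at hle'
      omega

/-- The closed neighbourhood sum of an isolated vertex is its own label, so only the diagonal of its
table matters. -/
theorem tableCost_isolated (hx : x ∈ U)
    (hc : ∀ u ∈ U, c u x ↔ u = x) (hc' : ∀ u ∈ U, c x u ↔ u = x)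
    (hA : ∀ u ∈ U, u ≠ x → ∀ p ≤ 3, ∀ q ≤ 3, A' u p q = A u p q)
    {b b' : V → ℕ} (hb3 : ∀ u, b u ≤ 3) (hb : ∀ w ∈ U, w ≠ x → b' w = b w) :
    tableCost c U A b = tableCost c (U.erase x) A' b' + A x (b x) (b x) := by
  classical
  have hbb : ∀ u, closedSum c (U.erase x) b' u = closedSum c (U.erase x) b u := fun u =>
    closedSum_congr (fun w hw => hb w (Finset.mem_erase.1 hw).2 (Finset.mem_erase.1 hw).1) u
  unfold tableCost
  rw [← Finset.sum_erase_add _ _ hx]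
  have h1 : closedSum c U b x = b x := by
    rw [closedSum_erase hx, if_pos ((hc' x hx).2 rfl)]
    have : closedSum c (U.erase x) b x = 0 :=
      Finset.sum_eq_zero fun w hw => by
        simp only [Finset.mem_erase] at hw
        rw [if_neg fun h => hw.1 ((hc' w hw.2).1 h)]
    omega
  rw [h1, min_eq_left (hb3 x)]
  congr 1
  refine Finset.sum_congr rfl fun u hu => ?_
  simp only [Finset.mem_erase] at hu
  rw [hbb, closedSum_erase hx, if_neg fun h => hu.1 ((hc u hu.2).1 h), add_zero,
    hb u hu.2 hu.1, hA u hu.2 hu.1 _ (hb3 u) _ (min_le_right _ _)]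

/-- Deleting an isolated vertex `x`. -/
theorem IsOptimum.isolated (h : IsOptimum c U A a γ) (hγ : γ ≤ B) (hx : x ∈ U)
    (hc : ∀ u ∈ U, c u x ↔ u = x) (hc' : ∀ u ∈ U, c x u ↔ u = x)
    (hA : ∀ u ∈ U, u ≠ x → ∀ p ≤ 3, ∀ q ≤ 3, A' u p q = A u p q)
    (hle : ∀ j ≤ 3, a' ≤ A x j j + a) (hge : B ≤ a' ∨ ∃ j ≤ 3, A x j j + a ≤ a') :
    IsOptimum c (U.erase x) A' a' γ := by
  obtain ⟨⟨b, hb3, hb⟩, hopt⟩ := h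
  refine ⟨⟨b, hb3, ?_⟩, fun b' hb' => ?_⟩
  · have h1 := tableCost_isolated hx hc hc' hA hb3 (b' := b) (fun _ _ _ => rfl)
    have := hle (b x) (hb3 x)
    omega
  · rcases hge with hB | ⟨j, hj, hle'⟩
    · omega
    · have hb3 : ∀ u, Function.update b' x j u ≤ 3 := fun u => by
        rcases eq_or_ne u x with rfl | hux
        · simpa using hj
        · rw [Function.update_of_ne hux]; exact hb' u
      have h1 := tableCost_isolated hx hc hc' hA hb3
        (b' := b') (fun w _ h => (Function.update_of_ne h _ _).symm)
      have := hopt _ hb3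
      rw [Function.update_self] at h1
      omega

end Elimination

/-! ### Roman {3}-domination as a cost minimisation problem -/

/-- The closed adjacency relation of a graph on the numbers below `n`. -/
def closedAdj {n : ℕ} (G : SimpleGraph (Fin n)) (x y : ℕ) : Prop :=
  x = y ∨ (G.map Fin.valEmbedding).Adj x y

theorem closedAdj_comm {n : ℕ} {G : SimpleGraph (Fin n)} {x y : ℕ} :
    closedAdj G x y ↔ closedAdj G y x := by
  unfold closedAdj
  rw [eq_comm, SimpleGraph.adj_comm]

theorem closedAdj_val {n : ℕ} {G : SimpleGraph (Fin n)} {x y : Fin n} :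
    closedAdj G x y ↔ x = y ∨ G.Adj x y := by
  unfold closedAdj
  rw [Fin.ext_iff]
  exact or_congr_right SimpleGraph.map_adj_apply

/-- The cost of a vertex with label `p` whose closed neighbourhood has weight `q`: a vertex that
is not dominated gets the label `2` instead. -/
def initialTable (p q : ℕ) : ℕ := if 2 ≤ p ∨ 3 ≤ q then p else 2

-- Adding the label of `u` to the neighbourhood sum turns the bounds for the labels 0 and 1 into the
-- common bound 3.
open Classical in
theorem isRoman3Dominating_iff {n : ℕ} {G : SimpleGraph (Fin n)} {f : Fin n → Fin 4} :
    IsRoman3Dominating G f ↔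
      ∀ u, 2 ≤ (f u : ℕ) ∨ 3 ≤ ∑ v : Fin n, if closedAdj G u v then (f v : ℕ) else 0 := by
  refine forall_congr' fun u => ?_
  have h : (∑ v : Fin n, if closedAdj G u v then (f v : ℕ) else 0) =
      (f u : ℕ) + ∑ v ∈ Finset.univ.filter (fun v => G.Adj u v), (f v : ℕ) := by
    rw [Finset.sum_filter, ← Finset.add_sum_erase _ _ (Finset.mem_univ u),
      ← Finset.add_sum_erase _ (fun v => if G.Adj u v then (f v : ℕ) else 0) (Finset.mem_univ u)]
    simp only [closedAdj_val, true_or, if_true, SimpleGraph.irrefl, if_false, zero_add]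
    congr 1
    refine Finset.sum_congr rfl fun v hv => ?_
    simp [(Finset.ne_of_mem_erase hv).symm]
  rw [h]
  simp only [Fin.ext_iff]
  simp only [Fin.val_zero, Fin.val_one]
  omega

theorem gammaR3_le {n : ℕ} (G : SimpleGraph (Fin n)) : gammaR3 G ≤ 2 * n := by
  refine (gammaR3_isLeast G).2 ⟨fun _ => 2, ?_, ?_⟩
  · exact isRoman3Dominating_iff.2 fun _ => Or.inl le_rfl
  · simp [mul_comm]

theorem isOptimum_gammaR3 {n : ℕ} (G : SimpleGraph (Fin n)) {A : ℕ → ℕ → ℕ → ℕ}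
    (hA : ∀ u < n, ∀ p ≤ 3, ∀ q ≤ 3, A u p q = initialTable p q) :
    IsOptimum (closedAdj G) (Finset.range n) A 0 (gammaR3 G) := by
  classical
  have hS : ∀ (b : ℕ → ℕ) (u : Fin n), closedSum (closedAdj G) (Finset.range n) b u =
      ∑ v : Fin n, if closedAdj G u v then b v else 0 := fun b u => by
    unfold closedSum
    rw [Finset.sum_range]
  have hcost : ∀ b : ℕ → ℕ, (∀ u, b u ≤ 3) →
      tableCost (closedAdj G) (Finset.range n) A b = ∑ u : Fin n, initialTable (b u)
        (min (∑ v : Fin n, if closedAdj G u v then b v else 0) 3) := fun b hb => by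
    unfold tableCost
    rw [Finset.sum_range]
    exact Finset.sum_congr rfl fun u _ => by
      rw [hA u u.2 _ (hb u) _ (min_le_right _ _), hS]
  constructor
  · obtain ⟨f, hf, hw⟩ := (gammaR3_isLeast G).1
    have hbf : ∀ u : Fin n, (if h : (u : ℕ) < n then (f ⟨u, h⟩ : ℕ) else 0) = f u := fun u => by
      simp
    have hb3 : ∀ u : ℕ, (if h : u < n then (f ⟨u, h⟩ : ℕ) else 0) ≤ 3 := fun u => by
      split_ifs
      · omega
      · omega
    refine ⟨fun u => if h : u < n then (f ⟨u, h⟩ : ℕ) else 0, hb3, ?_⟩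
    rw [hcost _ hb3, zero_add, ← hw]
    refine (Finset.sum_congr rfl fun u _ => ?_).le
    simp only [hbf]
    have := isRoman3Dominating_iff.1 hf u
    unfold initialTable
    rw [if_pos]
    omega
  · intro b hb
    rw [zero_add, hcost b hb]
    -- `g` raises every undominated vertex to 2. As `b ≤ g`, the sums only grow and the dominated
    -- vertices stay dominated, so the cost of `b` is the weight of an admissible labelling.
    set g : Fin n → ℕ := fun u => initialTable (b u)
        (min (∑ v : Fin n, if closedAdj G u v then b v else 0) 3) with hg
    have hg4 : ∀ u, g u < 4 := fun u => by
      have := hb u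
      simp only [hg, initialTable]
      split_ifs <;> omega
    have hgb : ∀ u : Fin n, b u ≤ g u := fun u => by
      simp only [hg, initialTable]
      split_ifs <;> omega
    refine (gammaR3_isLeast G).2 ⟨fun u : Fin n => ⟨g u, hg4 u⟩, ?_, rfl⟩
    refine isRoman3Dominating_iff.2 fun u => ?_
    have hle : (∑ v : Fin n, if closedAdj G u v then b v else 0) ≤
        ∑ v : Fin n, if closedAdj G u v then g v else 0 :=
      Finset.sum_le_sum fun v _ => by
        split_ifs
        · exact hgb v
        · exact le_rfl
    simp only
    by_cases h2 : 2 ≤ g u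
    · exact Or.inl h2
    · right
      refine le_trans ?_ hle
      simp only [hg, initialTable] at h2
      split_ifs at h2 <;> omega

/-! ### Recognising the vertex to eliminate by counting -/

open Classical in
/-- For `x ≠ y`, the number of vertices in `U` that distinguish `x` and `y`; for `x = y`, the size
of the closed neighbourhood of `x` in `U`. -/
noncomputable def distCount {V : Type*} (c : V → V → Prop) (U : Finset V) (x y : V) : ℕ :=
  (U.filter fun w => ¬ (c x w ↔ (x ≠ y ∧ c y w))).card

/-- The criterion by which the vertex `x` is chosen for elimination, with `y = x` if `x` is
isolated, and `y` a neighbour of `x` otherwise. -/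
def Eliminable {V : Type*} (c : V → V → Prop) (U : Finset V) (x y : V) : Prop :=
  x ∈ U ∧ y ∈ U ∧ c x y ∧ ((x = y ∧ distCount c U x x = 1) ∨
    (x ≠ y ∧ (distCount c U x x = 2 ∨ distCount c U x y = 0)))

section Counting

variable {V : Type*} {c : V → V → Prop} {U : Finset V} {x y z : V}

-- This recursion makes the counts cheap: adding or deleting one vertex `z` changes each by at most
-- one, as decided by two adjacency entries.
open Classical in
theorem distCount_erase [DecidableEq V] (hz : z ∈ U) : distCount c U x y =
    distCount c (U.erase z) x y + if c x z ↔ (x ≠ y ∧ c y z) then 0 else 1 := by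
  unfold distCount
  conv_lhs => rw [← Finset.insert_erase hz, Finset.filter_insert]
  by_cases h : c x z ↔ (x ≠ y ∧ c y z)
  · rw [if_neg (not_not.2 h), if_pos h, add_zero]
  · rw [if_pos h, if_neg h, Finset.card_insert_of_notMem (by simp)]

theorem distCount_self_eq_one (hx : x ∈ U) (hr : c x x) :
    distCount c U x x = 1 ↔ ∀ w ∈ U, c x w ↔ w = x := by
  classical
  unfold distCount
  simp only [ne_eq, not_true_eq_false, false_and, iff_false, not_not]
  rw [Finset.card_eq_one]
  constructor
  · rintro ⟨a, ha⟩ w hw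
    have h1 : x ∈ ({a} : Finset V) := ha ▸ Finset.mem_filter.2 ⟨hx, hr⟩
    rw [Finset.mem_singleton] at h1
    subst h1
    have := Finset.ext_iff.1 ha w
    simpa [hw] using this
  · intro h
    refine ⟨x, Finset.ext fun w => ?_⟩
    simp only [Finset.mem_filter, Finset.mem_singleton]
    exact ⟨fun hw => (h w hw.1).1 hw.2, fun hw => by subst hw; exact ⟨hx, hr⟩⟩

theorem distCount_self_eq_two (hx : x ∈ U) (hy : y ∈ U) (hxy : x ≠ y) (hr : c x x) (hc : c x y) :
    distCount c U x x = 2 ↔ ∀ w ∈ U, c x w ↔ w = x ∨ w = y := by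
  classical
  unfold distCount
  simp only [ne_eq, not_true_eq_false, false_and, iff_false, not_not]
  have hsub : ({x, y} : Finset V) ⊆ U.filter fun w => c x w := by
    intro w hw
    simp only [Finset.mem_insert, Finset.mem_singleton] at hw
    rcases hw with rfl | rfl <;> simp [*]
  have h2 : ({x, y} : Finset V).card = 2 := Finset.card_pair hxy
  constructor
  · intro h w hw
    have := Finset.eq_of_subset_of_card_le hsub (by omega)
    have := Finset.ext_iff.1 this w
    simp only [Finset.mem_insert, Finset.mem_singleton, Finset.mem_filter, hw, true_and] at this
    exact this.symm
  · intro h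
    rw [← h2]
    congr 1
    refine Finset.Subset.antisymm (fun w hw => ?_) hsub
    rw [Finset.mem_filter] at hw
    simpa using (h w hw.1).1 hw.2

theorem distCount_eq_zero (hxy : x ≠ y) :
    distCount c U x y = 0 ↔ ∀ w ∈ U, c x w ↔ c y w := by
  classical
  unfold distCount
  simp [Finset.filter_eq_empty_iff, hxy]

end Counting

-- Vertices are numbers, ready to be used in addresses, so the block graph property is transported
-- along `Fin.valEmbedding`. A walk inside `U` is a walk in `G`, hence deletions do no harm. `U`
-- needs no bound, as numbers from `n` on are isolated.
open Relation in
theorem exists_eliminable {n : ℕ} {G : SimpleGraph (Fin n)} (hG : IsBlockGraph G) {U : Finset ℕ}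
    (hU : U.Nonempty) : ∃ x y, Eliminable (closedAdj G) U x y := by
  have hr : ∀ x, closedAdj G x x := fun x => Or.inl rfl
  have hK : ∀ v x y, (G.map Fin.valEmbedding).Adj v x → (G.map Fin.valEmbedding).Adj v y →
      ReflTransGen (fun a b => (G.map Fin.valEmbedding).Adj a b ∧ a ∈ (U : Set ℕ) \ {v} ∧
        b ∈ (U : Set ℕ) \ {v}) x y → x ≠ y → (G.map Fin.valEmbedding).Adj x y := by
    intro v x y hx hy hxy hne
    obtain ⟨v, x, hvx, rfl, rfl⟩ := (SimpleGraph.map_adj _ _ _ _).1 hx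
    obtain ⟨v', y, hvy, hv, rfl⟩ := (SimpleGraph.map_adj _ _ _ _).1 hy
    obtain rfl := Fin.valEmbedding.injective hv
    rw [SimpleGraph.map_adj_apply]
    refine hG.adj_of_reflTransGen hvx hvy ?_ (fun h => hne (by rw [h]))
    have : ∀ z, ReflTransGen (fun a b => (G.map Fin.valEmbedding).Adj a b ∧
        a ∈ (U : Set ℕ) \ {Fin.valEmbedding v'} ∧ b ∈ (U : Set ℕ) \ {Fin.valEmbedding v'})
        (Fin.valEmbedding x) z → ∀ y, Fin.valEmbedding y = z →
        ReflTransGen (fun a b => G.Adj a b ∧ a ≠ v' ∧ b ≠ v') x y := by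
      intro z hz
      induction hz with
      | refl => intro y hy; rw [Fin.valEmbedding.injective hy]
      | tail h1 h2 ih =>
        rintro y rfl
        obtain ⟨h3, h4, h5⟩ := h2
        obtain ⟨p, q, hpq, rfl, hq⟩ := (SimpleGraph.map_adj _ _ _ _).1 h3
        obtain rfl := Fin.valEmbedding.injective hq
        exact (ih p rfl).tail ⟨hpq, fun h => h4.2 (by rw [h]; rfl), fun h => h5.2 (by rw [h]; rfl)⟩
    exact this _ hxy y rfl
  rcases exists_isolated_or_pendant_or_twins hU hK with
    ⟨x, hx, h⟩ | ⟨x, hx, y, hy, hxy, h⟩ | ⟨x, hx, y, hy, hxy, h⟩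
  · refine ⟨x, x, hx, hx, hr x, Or.inl ⟨rfl, (distCount_self_eq_one hx (hr x)).2 fun w hw => ?_⟩⟩
    exact ⟨fun hc => hc.elim Eq.symm fun hc => absurd hc (h w hw), fun hc => Or.inl hc.symm⟩
  · refine ⟨x, y, hx, hy, Or.inr hxy, Or.inr ⟨hxy.ne, Or.inl ?_⟩⟩
    refine (distCount_self_eq_two hx hy hxy.ne (hr x) (Or.inr hxy)).2 fun w hw => ?_
    refine ⟨fun hc => hc.elim (fun hc => Or.inl hc.symm) fun hc => Or.inr (h w hw hc), ?_⟩
    rintro (rfl | rfl)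
    · exact hr w
    · exact Or.inr hxy
  · refine ⟨x, y, hx, hy, Or.inr hxy, Or.inr ⟨hxy.ne, Or.inr ?_⟩⟩
    refine (distCount_eq_zero hxy.ne).2 fun w hw => ?_
    rcases eq_or_ne w x with rfl | hwx
    · exact iff_of_true (hr _) (Or.inr hxy.symm)
    rcases eq_or_ne w y with rfl | hwy
    · exact iff_of_true (Or.inr hxy) (hr _)
    · unfold closedAdj
      rw [h w hw hwx hwy]
      simp [hwx.symm, hwy.symm]

/-! ### Straight-line programs -/

namespace RAM

/-- All instructions of a straight-line program stay below the word size. -/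
def BlockOk (W : ℕ) : List Instr → State → Prop
  | [], _ => True
  | i :: l, s => i.value s < W ∧ BlockOk W l (i.apply s)

/-- The result of a straight-line program. -/
def runBlock : List Instr → State → State
  | [], s => s
  | i :: l, s => runBlock l (i.apply s)

theorem Runs.block {W : ℕ} {l : List Instr} {s : State} {Post : State → ℕ → Prop}
    (hok : BlockOk W l s) (h : Post (runBlock l s) l.length) : Runs W (block l) s Post := by
  suffices H : Exec W (RAM.block l) s (runBlock l s) l.length from ⟨_, _, H, h⟩
  clear h
  induction l generalizing s with
  | nil => exact .skip s
  | cons i l ih =>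
    have := Exec.seq (.instr i s hok.1) (ih hok.2)
    rwa [add_comm, List.length_cons.symm] at this

/-! ### Memory layout -/

/-- Address of an entry of the adjacency matrix. -/
def addrM (n x y : ℕ) : ℕ := x * n + y

/-- Address of an entry of the matrix of the numbers `distCount`. -/
def addrQ (n x y : ℕ) : ℕ := x * n + y + n * n

/-- Address of an entry of the cost table of `u`. -/
def addrA (n u i j : ℕ) : ℕ := u * 16 + i * 4 + j + (n * n + n * n)

theorem mul_add_le {n x : ℕ} (hx : x < n) : x * n + n ≤ n * n := by
  calc x * n + n = (x + 1) * n := by ring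
    _ ≤ n * n := Nat.mul_le_mul_right n hx

theorem addrM_inj {n x y x' y' : ℕ} (hy : y < n) (hy' : y' < n) :
    addrM n x y = addrM n x' y' ↔ x = x' ∧ y = y' := by
  refine ⟨fun h => ?_, fun h => by rw [h.1, h.2]⟩
  unfold addrM at h
  have hx : x = x' := by
    have h1 := congrArg (· / n) h
    simpa [Nat.mul_add_div (by omega : n > 0), mul_comm _ n, Nat.div_eq_of_lt hy,
      Nat.div_eq_of_lt hy'] using h1
  subst hx
  exact ⟨rfl, by omega⟩

/-! ### Independence of the three memory regions -/

section Update

variable {n : ℕ} {m : ℕ → ℕ} {v x y x' y' u i j u' i' j' : ℕ}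

theorem update_addrM_addrM (hy : y < n) (hy' : y' < n) :
    Function.update m (addrM n x y) v (addrM n x' y') =
      if x' = x ∧ y' = y then v else m (addrM n x' y') := by
  simp only [Function.update_apply, addrM_inj hy' hy]

theorem update_addrQ_addrQ (hy : y < n) (hy' : y' < n) :
    Function.update m (addrQ n x y) v (addrQ n x' y') =
      if x' = x ∧ y' = y then v else m (addrQ n x' y') := by
  have : addrQ n x' y' = addrQ n x y ↔ x' = x ∧ y' = y := by
    rw [← addrM_inj hy' hy]
    simp [addrQ, addrM]
  simp only [Function.update_apply, this]

theorem update_addrA_addrA (hi : i < 4) (hj : j < 4) (hi' : i' < 4) (hj' : j' < 4) :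
    Function.update m (addrA n u i j) v (addrA n u' i' j') =
      if u' = u ∧ i' = i ∧ j' = j then v else m (addrA n u' i' j') := by
  have : addrA n u' i' j' = addrA n u i j ↔ u' = u ∧ i' = i ∧ j' = j := by
    unfold addrA
    omega
  simp only [Function.update_apply, this]

theorem update_addrM_addrQ (hx : x < n) (hy : y < n) :
    Function.update m (addrM n x y) v (addrQ n x' y') = m (addrQ n x' y') := by
  refine Function.update_of_ne ?_ _ _
  have := mul_add_le hx
  unfold addrM addrQ
  omega

theorem update_addrM_addrA (hx : x < n) (hy : y < n) :
    Function.update m (addrM n x y) v (addrA n u i j) = m (addrA n u i j) := by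
  refine Function.update_of_ne ?_ _ _
  have := mul_add_le hx
  unfold addrM addrA
  omega

theorem update_addrQ_addrM (hx' : x' < n) (hy' : y' < n) :
    Function.update m (addrQ n x y) v (addrM n x' y') = m (addrM n x' y') := by
  refine Function.update_of_ne ?_ _ _
  have := mul_add_le hx'
  unfold addrM addrQ
  omega

theorem update_addrQ_addrA (hx : x < n) (hy : y < n) :
    Function.update m (addrQ n x y) v (addrA n u i j) = m (addrA n u i j) := by
  refine Function.update_of_ne ?_ _ _
  have := mul_add_le hx
  unfold addrQ addrA
  omega

theorem update_addrA_addrM (hx' : x' < n) (hy' : y' < n) :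
    Function.update m (addrA n u i j) v (addrM n x' y') = m (addrM n x' y') := by
  refine Function.update_of_ne ?_ _ _
  have := mul_add_le hx'
  unfold addrM addrA
  omega

theorem update_addrA_addrQ (hx' : x' < n) (hy' : y' < n) :
    Function.update m (addrA n u i j) v (addrQ n x' y') = m (addrQ n x' y') := by
  refine Function.update_of_ne ?_ _ _
  have := mul_add_le hx'
  unfold addrQ addrA
  omega

end Update

/-! ### Maintaining the counts when a vertex is added or deleted -/

/-- The registers `0, …, 9` hold constants. -/
structure Consts (n : ℕ) (s : State) : Prop where
  r0 : s.reg 0 = n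
  r1 : s.reg 1 = 1
  r2 : s.reg 2 = n * n
  r3 : s.reg 3 = n * n + n * n
  r4 : s.reg 4 = 4
  r5 : s.reg 5 = 2 * n + 3
  r6 : s.reg 6 = 3
  r7 : s.reg 7 = 2
  r8 : s.reg 8 = 16
  r9 : s.reg 9 = n + 1

theorem Consts.congr {n : ℕ} {s s' : State} (h : Consts n s) (hs : ∀ q < 10, s'.reg q = s.reg q) :
    Consts n s' := by
  obtain ⟨h0, h1, h2, h3, h4, h5, h6, h7, h8, h9⟩ := h
  constructor <;> rw [hs _ (by norm_num)] <;> assumption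

/-- `Q[x, y] := op Q[x, y] 1` for all `x, y` that are distinguished by the vertex in register
`11`. -/
def updateCounts (op : ℕ → ℕ → ℕ → Instr) : Program :=
  forLoop 14 0 <| forLoop 15 0 <|
    .seq (block [.mul 20 14 0, .add 20 20 11, .load 21 20, .mul 22 15 0, .add 22 22 11,
      .load 23 22]) <|
    .seq (.ite (.eq 14 15) (block [.const 23 0]) .skip) <|
    .ite (.eq 21 23) .skip
      (block [.mul 24 14 0, .add 24 24 15, .add 24 24 2, .load 25 24, op 25 25 1, .store 24 25])

/-- `f` is addition during the set-up and truncated subtraction for deletions; `hf` is all that the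
overflow check needs. Comparing with 0 when `x = y` makes the diagonal count closed neighbours. -/
theorem runs_updateCounts {n W z : ℕ} {s : State} (hs : Consts n s)
    (hW : 2 * (n * n) + 100 * n + 100 ≤ W) (hz : z < n) (h11 : s.reg 11 = z)
    {op : ℕ → ℕ → ℕ → Instr} {f : ℕ → ℕ → ℕ} (hf : ∀ q, f q 1 ≤ q + 1)
    (hv : ∀ d a b s, (op d a b).value s = f (s.reg a) (s.reg b))
    (ha : ∀ d a b s, (op d a b).apply s =
      ⟨Function.update s.reg d (f (s.reg a) (s.reg b)), s.mem⟩)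
    (hM : ∀ x < n, ∀ y < n, s.mem (addrM n x y) ≤ 1)
    (hQ : ∀ x < n, ∀ y < n, s.mem (addrQ n x y) ≤ n) :
    Runs W (updateCounts op) s fun s' t => t ≤ n * (n * 18 + 4) + 2 ∧
      (∀ q < 14, s'.reg q = s.reg q) ∧
      (∀ x < n, ∀ y < n, s'.mem (addrM n x y) = s.mem (addrM n x y)) ∧
      (∀ u i j, s'.mem (addrA n u i j) = s.mem (addrA n u i j)) ∧
      (∀ x < n, ∀ y < n, s'.mem (addrQ n x y) =
        if s.mem (addrM n x z) = (if x = y then 0 else s.mem (addrM n y z))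
        then s.mem (addrQ n x y) else f (s.mem (addrQ n x y)) 1) := by
  obtain ⟨g, hg⟩ : ∃ g : ℕ → ℕ → ℕ, ∀ x y, g x y =
      if s.mem (addrM n x z) = (if x = y then 0 else s.mem (addrM n y z))
      then s.mem (addrQ n x y) else f (s.mem (addrQ n x y)) 1 := ⟨_, fun _ _ => rfl⟩
  simp only [← hg]
  -- Entries lexicographically before `(a, b)` are final, the others untouched. An update reads only
  -- adjacency entries and its own cell, so the updates do not interfere.
  refine (Runs.of_forLoop₂ (T := 16) (N := n) (N' := n) (fun a b s' =>
      (∀ x < n, ∀ y < n, s'.mem (addrM n x y) = s.mem (addrM n x y)) ∧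
      (∀ u i j, s'.mem (addrA n u i j) = s.mem (addrA n u i j)) ∧
      (∀ x < n, ∀ y < n, s'.mem (addrQ n x y) =
        if x < a ∨ x = a ∧ y < b then g x y else s.mem (addrQ n x y)))
    (by norm_num) (by norm_num) (by norm_num) (by norm_num) hs.r0 hs.r0 hs.r1 (by omega) (by omega)
    (fun _ _ _ _ h => h) (fun _ _ _ _ h => h) ?_ ?_ ?_).mono ?_
  · simp
  · rintro a ha' s' ⟨h1, h2, h3⟩
    refine ⟨h1, h2, fun x hx y hy => ?_⟩
    rw [h3 x hx y hy]
    exact if_congr (by omega) rfl rfl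
  · rintro a ha' b hb ⟨r, m⟩ hr h14 h15 ⟨h1, h2, h3⟩
    have hc : Consts n ⟨r, m⟩ := hs.congr fun q hq => hr q (by omega)
    obtain ⟨c0, c1, c2, -, -, -, -, -, -, -⟩ := hc
    rw [← hr 11 (by norm_num)] at h11
    simp only at c0 c1 c2 h14 h15 h11 h1 h2 h3
    have hab := h3 a ha' b hb
    rw [if_neg (by omega)] at hab
    have e1 := h1 a ha' z hz
    have e2 := h1 b hb z hz
    have l1 := hM a ha' z hz
    have l2 := hM b hb z hz
    have l3 := hQ a ha' b hb
    have l4 := hf (s.mem (addrQ n a b))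
    have p1 := mul_add_le ha'
    have p2 := mul_add_le hb
    have hgab := hg a b
    rw [← hab] at hgab l3 l4
    rw [← e1, ← e2] at hgab
    rw [← e1] at l1
    rw [← e2] at l2
    refine Runs.seq (Runs.block ?_ ?_)
    · simp [BlockOk, Instr.value, Instr.apply, c0, h14, h15, h11]
      unfold addrM at l1 l2
      omega
    refine Runs.seq (Runs.mono (Post := fun s1 t1 => t1 ≤ 2 ∧ s1.mem = m ∧
      (∀ q < 20, s1.reg q = r q) ∧ s1.reg 21 = m (addrM n a z) ∧
      s1.reg 23 = if a = b then 0 else m (addrM n b z)) (Runs.ite (fun hb => ?_) fun hb => ?_) ?_)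
    · simp [runBlock, Test.Holds, Instr.value, Instr.apply, c0, h14, h15, h11] at hb ⊢
      refine Runs.block ?_ ?_
      · simp [BlockOk, Instr.value]
        omega
      · simp [runBlock, Instr.value, Instr.apply, hb, addrM]
        intro q hq
        simp (disch := omega) only [Function.update_of_ne]
    · simp [runBlock, Test.Holds, Instr.value, Instr.apply, c0, h14, h15, h11] at hb ⊢
      refine Runs.skip ?_
      simp [hb, addrM]
      intro q hq
      simp (disch := omega) only [Function.update_of_ne]
    · rintro ⟨r1, m1⟩ t1 ⟨ht1, hm, hr1, h21, h23⟩
      obtain rfl : m1 = m := hm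
      simp only at hr1 h21 h23
      rw [← h21, ← h23] at hgab
      refine Runs.ite (fun hb => ?_) fun hb => ?_
      · refine Runs.skip ⟨by simp; omega, fun q hq => hr1 q (by simp at hq; omega), h1, h2,
          fun x hx y hy => ?_⟩
        rw [if_pos (show r1 21 = r1 23 from hb)] at hgab
        refine (h3 x hx y hy).trans ?_
        by_cases hxy : x = a ∧ y = b
        · obtain ⟨rfl, rfl⟩ := hxy
          rw [if_neg (by omega), if_pos (by omega), hgab, hab]
        · exact if_congr (by omega) rfl rfl
      · rw [if_neg (show ¬ r1 21 = r1 23 from hb)] at hgab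
        have q0 := hr1 0 (by norm_num)
        have q1 := hr1 1 (by norm_num)
        have q2 := hr1 2 (by norm_num)
        have q11 := hr1 11 (by norm_num)
        have q14 := hr1 14 (by norm_num)
        have q15 := hr1 15 (by norm_num)
        rw [c0] at q0
        rw [c1] at q1
        rw [c2] at q2
        rw [h14] at q14
        rw [h15] at q15
        refine Runs.block ?_ ?_
        · simp only [BlockOk, hv, ha]
          simp [Instr.value, Instr.apply, q0, q1, q2, q14, q15]
          unfold addrQ at l3 l4
          omega
        · simp only [runBlock, ha]
          simp [Instr.value, Instr.apply, q0, q1, q2, q14, q15]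
          refine ⟨by omega, fun q hq => ?_, ?_⟩
          · simp (disch := omega) only [Function.update_of_ne]
            exact hr1 q (by omega)
          · rw [show a * n + b + n * n = addrQ n a b from rfl]
            refine ⟨fun x hx y hy => ?_, fun u i j => ?_, fun x hx y hy => ?_⟩
            · rw [update_addrQ_addrM hx hy, h1 x hx y hy]
            · rw [update_addrQ_addrA ha' ‹_›, h2]
            · rw [update_addrQ_addrQ ‹_› hy, ← hgab, h3 x hx y hy]
              by_cases hxy : x = a ∧ y = b
              · obtain ⟨rfl, rfl⟩ := hxy
                rw [if_pos ⟨rfl, rfl⟩, if_pos (by omega)]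
              · rw [if_neg hxy]
                exact if_congr (by omega) rfl rfl
  · rintro s' t ⟨ht, hr, h1, h2, h3⟩
    refine ⟨ht, hr, h1, h2, fun x hx y hy => ?_⟩
    rw [h3 x hx y hy, if_pos (Or.inl hx)]

/-! ### Initial registers and cost tables -/

/-- Sets up the registers `1, …, 9`. -/
def setConsts : Program :=
  block [.const 1 1, .mul 2 0 0, .add 3 2 2, .const 4 4, .add 5 0 0, .const 6 3, .add 5 5 6,
    .const 7 2, .const 8 16, .add 9 0 1]

theorem runs_setConsts {n W : ℕ} {s : State} (h0 : s.reg 0 = n)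
    (hW : 2 * (n * n) + 100 * n + 100 ≤ W) :
    Runs W setConsts s fun s' t => t ≤ 10 ∧ s'.mem = s.mem ∧ Consts n s' := by
  refine Runs.block ?_ ?_
  · simp [BlockOk, Instr.value, Instr.apply, h0]
    omega
  · simp [runBlock, Instr.value, Instr.apply, h0]
    constructor <;> simp [two_mul, h0]

/-- Marks all vertices as live on the diagonal of the adjacency matrix and initialises their cost
tables. -/
def initTables : Program :=
  forLoop 10 0 <|
    .seq (block [.mul 20 10 0, .add 20 20 10, .store 20 1]) <|
    forLoop 14 4 <| forLoop 15 4 <|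
      .seq (block [.mul 20 10 8, .mul 21 14 4, .add 20 20 21, .add 20 20 15, .add 20 20 3,
        .move 22 14]) <|
      .seq (.ite (.lt 14 7) (.ite (.lt 15 6) (block [.move 22 7]) .skip) .skip) <|
      block [.store 20 22]

/-- The last clause preserves the table of the dummy vertex `n`: it is zero in the input and will
collect the additive constant. -/
theorem runs_initTables {n W : ℕ} {s : State} (hs : Consts n s)
    (hW : 2 * (n * n) + 100 * n + 100 ≤ W) :
    Runs W initTables s fun s' t => t ≤ n * 282 + 2 ∧ (∀ q < 10, s'.reg q = s.reg q) ∧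
      (∀ x < n, ∀ y < n, s'.mem (addrM n x y) = if x = y then 1 else s.mem (addrM n x y)) ∧
      (∀ x < n, ∀ y < n, s'.mem (addrQ n x y) = s.mem (addrQ n x y)) ∧
      (∀ u < n, ∀ i < 4, ∀ j < 4, s'.mem (addrA n u i j) = initialTable i j) ∧
      (∀ i < 4, ∀ j < 4, s'.mem (addrA n n i j) = s.mem (addrA n n i j)) := by
  refine (Runs.of_forLoop (T := 280) (N := n) (fun a s' =>
    (∀ x < n, ∀ y < n, s'.mem (addrM n x y) =
      if x = y ∧ x < a then 1 else s.mem (addrM n x y)) ∧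
    (∀ x < n, ∀ y < n, s'.mem (addrQ n x y) = s.mem (addrQ n x y)) ∧
    (∀ u < a, ∀ i < 4, ∀ j < 4, s'.mem (addrA n u i j) = initialTable i j) ∧
    (∀ i < 4, ∀ j < 4, s'.mem (addrA n n i j) = s.mem (addrA n n i j)))
    (by norm_num) (by norm_num) hs.r0 hs.r1 (by omega) (fun _ _ _ h => h) ?_ ?_).mono ?_
  · simp
  · rintro a ha ⟨r, m⟩ hr h10 ⟨h1, h2, h3, h4⟩
    have hc : Consts n ⟨r, m⟩ := hs.congr fun q hq => hr q (by omega)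
    have p1 := mul_add_le ha
    obtain ⟨c0, c1, -, -, -, -, -, -, -, -⟩ := id hc
    simp only at c0 c1 h10 h1 h2 h3 h4
    refine Runs.seq (Runs.block ?_ ?_)
    · simp [BlockOk, Instr.value, Instr.apply, c0, c1, h10]
      omega
    simp only [runBlock, Instr.value, Instr.apply, Function.update_self, c0, h10, ne_eq,
      Nat.reduceEqDiff, not_false_eq_true, Function.update_of_ne, c1, List.length_cons,
      List.length_nil]
    rw [show a * n + a = addrM n a a from rfl]
    set m1 := Function.update m (addrM n a a) 1 with hm1
    set r1 := Function.update (Function.update r 20 (a * n)) 20 (addrM n a a) with hr1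
    have hrr : ∀ q < 20, r1 q = r q := fun q hq => by
      simp (disch := omega) only [hr1, Function.update_of_ne]
    have hc1 : Consts n ⟨r1, m1⟩ := hc.congr fun q hq => hrr q (by omega)
    refine (Runs.of_forLoop₂ (T := 14) (N := 4) (N' := 4) (fun i j s' =>
      (∀ x < n, ∀ y < n, s'.mem (addrM n x y) = m1 (addrM n x y)) ∧
      (∀ x < n, ∀ y < n, s'.mem (addrQ n x y) = m1 (addrQ n x y)) ∧
      (∀ u ≠ a, ∀ i < 4, ∀ j < 4, s'.mem (addrA n u i j) = m1 (addrA n u i j)) ∧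
      (∀ i' < 4, ∀ j' < 4, (i' < i ∨ i' = i ∧ j' < j) →
        s'.mem (addrA n a i' j') = initialTable i' j'))
      (by norm_num) (by norm_num) (by norm_num) (by norm_num) hc1.r4 hc1.r4 hc1.r1 (by omega)
      (by omega) (fun _ _ _ _ h => h) (fun _ _ _ _ h => h) ?_ ?_ ?_).mono ?_
    · simp
    · rintro i hi s' ⟨k1, k2, k3, k4⟩
      exact ⟨k1, k2, k3, fun i' hi' j' hj' h => k4 i' hi' j' hj' (by omega)⟩
    · rintro i hi j hj ⟨r2, m2⟩ hr2 h14 h15 ⟨k1, k2, k3, k4⟩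
      have hc2 : Consts n ⟨r2, m2⟩ := hc1.congr fun q hq => hr2 q (by omega)
      obtain ⟨d0, d1, d2, d3, d4, d5, d6, d7, d8, d9⟩ := id hc2
      have d10 : r2 10 = a := by
        have := hr2 10 (by norm_num)
        simp only at this
        rw [this, hrr 10 (by norm_num), h10]
      simp only at h14 h15 d0 d1 d2 d3 d4 d5 d6 d7 d8 d9
      refine Runs.seq (Runs.block ?_ ?_)
      · simp [BlockOk, Instr.value, Instr.apply, d10, d8, d4, d3, h14, h15]
        omega
      refine Runs.seq (Runs.mono (Post := fun s1 t1 => t1 ≤ 3 ∧ s1.mem = m2 ∧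
        (∀ q < 20, s1.reg q = r2 q) ∧ s1.reg 20 = addrA n a i j ∧
        s1.reg 22 = initialTable i j) ?_ ?_)
      · simp only [runBlock, Instr.value, Instr.apply, Function.update_self, ne_eq,
          Nat.reduceEqDiff, not_false_eq_true, Function.update_of_ne, d10, d8, d4, d3, h14, h15]
        rw [show a * 16 + i * 4 + j + (n * n + n * n) = addrA n a i j from rfl]
        -- The negated condition of `initialTable`, which is what the nested tests check.
        have hi0 : initialTable i j = if i < 2 ∧ j < 3 then 2 else i := by
          unfold initialTable
          split_ifs <;> omega
        refine Runs.ite (fun hb => Runs.ite (fun hb' => Runs.block ?_ ?_) fun hb' => Runs.skip ?_)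
          fun hb => Runs.skip ?_
        all_goals simp [BlockOk, runBlock, Test.Holds, Instr.value, Instr.apply, d7, h14]
          at hb ⊢
        all_goals try simp [Test.Holds, d6, h15] at hb'
        · omega
        · refine ⟨fun q hq => ?_, ?_⟩
          · simp (disch := omega) only [Function.update_of_ne]
          · rw [hi0, if_pos ⟨by omega, hb'⟩]
        · refine ⟨fun q hq => ?_, ?_⟩
          · simp (disch := omega) only [Function.update_of_ne]
          · rw [hi0, if_neg (by omega)]
        · refine ⟨fun q hq => ?_, ?_⟩
          · simp (disch := omega) only [Function.update_of_ne]
          · rw [hi0, if_neg (by omega)]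
      · rintro ⟨r3, m3⟩ t1 ⟨ht1, hm, hr3, h20, h22⟩
        obtain rfl : m3 = m2 := hm
        simp only at hr3 h20 h22 k1 k2 k3 k4
        have hlt : initialTable i j < W := by
          unfold initialTable
          split_ifs <;> omega
        refine Runs.block (by simpa [BlockOk, Instr.value, h22] using hlt) ?_
        simp [runBlock, Instr.value, Instr.apply, h20, h22]
        refine ⟨by omega, fun q hq => hr3 q (by omega), fun x hx y hy => ?_, fun x hx y hy => ?_,
          fun u hu i' hi' j' hj' => ?_, fun i' hi' j' hj' h => ?_⟩
        · rw [update_addrA_addrM hx hy, k1 x hx y hy]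
        · rw [update_addrA_addrQ hx hy, k2 x hx y hy]
        · rw [update_addrA_addrA hi hj hi' hj', if_neg (by tauto), k3 u hu i' hi' j' hj']
        · rw [update_addrA_addrA hi hj hi' hj']
          split_ifs with hif
          · rw [hif.2.1, hif.2.2]
          · exact k4 i' hi' j' hj' (by omega)
    · rintro s' t ⟨ht, hr', k1, k2, k3, k4⟩
      refine ⟨by omega, fun q hq => (hr' q (by omega)).trans (hrr q (by omega)),
        fun x hx y hy => ?_, fun x hx y hy => ?_, fun u hu i hi j hj => ?_, fun i hi j hj => ?_⟩
      · rw [k1 x hx y hy, hm1, update_addrM_addrM ha hy, h1 x hx y hy]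
        by_cases hxy : x = a ∧ y = a
        · rw [if_pos hxy, if_pos (by omega)]
        · rw [if_neg hxy]
          exact if_congr (by omega) rfl rfl
      · rw [k2 x hx y hy, hm1, update_addrM_addrQ ha ha, h2 x hx y hy]
      · by_cases hua : u = a
        · subst hua
          exact k4 i hi j hj (Or.inl hi)
        · rw [k3 u hua i hi j hj, hm1, update_addrM_addrA ha ha, h3 u (by omega) i hi j hj]
      · rw [k3 n (by omega) i hi j hj, hm1, update_addrM_addrA ha ha, h4 i hi j hj]
  · rintro s' t ⟨ht, hr, h1, h2, h3, h4⟩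
    refine ⟨by omega, hr, fun x hx y hy => ?_, h2, h3, h4⟩
    rw [h1 x hx y hy]
    exact if_congr (by omega) rfl rfl

/-! ### Searching for a vertex to eliminate -/

/-- The entries of the memory that make `x` a vertex to eliminate; `y = x` if `x` is isolated. -/
def Candidate (n : ℕ) (m : ℕ → ℕ) (x y : ℕ) : Prop :=
  m (addrM n x x) = 1 ∧ m (addrM n y y) = 1 ∧ m (addrM n x y) = 1 ∧
    (x = y ∧ m (addrQ n x y) = 1 ∨ x ≠ y ∧ (m (addrQ n x x) = 2 ∨ m (addrQ n x y) = 0))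

/-- Looks for a vertex to eliminate and writes it to register `30`. Registers `31` and `32` say
into which vertex (`n` for the dummy vertex) and how it will be merged. -/
def search : Program :=
  forLoop 14 0 <| forLoop 15 0 <|
    .seq (block [.mul 20 14 0, .add 21 20 14, .load 22 21, .add 21 21 2, .load 25 21,
      .add 21 20 15, .load 23 21, .add 21 21 2, .load 24 21, .mul 20 15 0, .add 20 20 15,
      .load 21 20, .mul 21 21 22, .mul 21 21 23]) <|
    .ite (.eq 21 1)
      (.ite (.eq 14 15)
        (.ite (.eq 24 1) (block [.move 30 14, .move 31 0, .const 32 1]) .skip)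
        (.ite (.eq 25 7) (block [.move 30 14, .move 31 15, .const 32 1])
          (.ite (.lt 24 1) (block [.move 30 14, .move 31 15, .const 32 2]) .skip)))
      .skip

/-- The result of `search` in the registers `30`, `31` and `32`. -/
def Found (n : ℕ) (m : ℕ → ℕ) (x y k : ℕ) : Prop :=
  x < n ∧ ((y = n ∧ k = 1 ∧ Candidate n m x x) ∨ (y < n ∧ x ≠ y ∧ Candidate n m x y ∧
    (k = 1 ∧ m (addrQ n x x) = 2 ∨ k = 2 ∧ m (addrQ n x y) = 0)))

/-- The scan does not stop at a hit, and later hits overwrite earlier ones. The invariant is that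
something has been found or no candidate has been passed; `hex` excludes the latter at the end. -/
theorem runs_search {n W : ℕ} {s : State} (hs : Consts n s)
    (hW : 2 * (n * n) + 100 * n + 100 ≤ W)
    (hM : ∀ x < n, ∀ y < n, s.mem (addrM n x y) ≤ 1)
    (hQ : ∀ x < n, ∀ y < n, s.mem (addrQ n x y) ≤ n)
    (hex : ∃ x < n, ∃ y < n, Candidate n s.mem x y) :
    Runs W search s fun s' t => t ≤ n * (n * 25 + 4) + 2 ∧ (∀ q < 14, s'.reg q = s.reg q) ∧
      s'.mem = s.mem ∧ Found n s.mem (s'.reg 30) (s'.reg 31) (s'.reg 32) := by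
  refine (Runs.of_forLoop₂ (T := 23) (N := n) (N' := n) (fun a b s' => s'.mem = s.mem ∧
    (Found n s.mem (s'.reg 30) (s'.reg 31) (s'.reg 32) ∨
      ∀ x < n, ∀ y < n, (x < a ∨ x = a ∧ y < b) → ¬ Candidate n s.mem x y))
    (by norm_num) (by norm_num) (by norm_num) (by norm_num) hs.r0 hs.r0 hs.r1 (by omega)
    (by omega) (fun _ _ _ _ h => by simpa using h) (fun _ _ _ _ h => by simpa using h) ?_ ?_
    ?_).mono ?_
  · simp
  · rintro a ha s' ⟨h1, h2⟩
    exact ⟨h1, h2.imp_right fun h x hx y hy hxy => h x hx y hy (by omega)⟩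
  · rintro a ha b hb ⟨r, m⟩ hr h14 h15 ⟨hm, h2⟩
    have hc : Consts n ⟨r, m⟩ := hs.congr fun q hq => hr q (by omega)
    obtain rfl : m = s.mem := hm
    obtain ⟨c0, c1, c2, c3, c4, c5, c6, c7, c8, c9⟩ := hc
    simp only at c0 c1 c2 c7 h14 h15 h2
    have p1 := mul_add_le ha
    have p2 := mul_add_le hb
    have l1 := hM a ha a ha
    have l2 := hM b hb b hb
    have l3 := hM a ha b hb
    have l4 := hQ a ha a ha
    have l5 := hQ a ha b hb
    have l6 := Nat.mul_le_mul l2 l1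
    have l7 := Nat.mul_le_mul l6 l3
    -- A product of three flags with values 0 and 1 needs only one test.
    have hlive : s.mem (addrM n b b) * s.mem (addrM n a a) * s.mem (addrM n a b) = 1 ↔
        s.mem (addrM n a a) = 1 ∧ s.mem (addrM n b b) = 1 ∧ s.mem (addrM n a b) = 1 := by
      simp only [mul_eq_one]
      tauto
    have hnot : ¬ Candidate n s.mem a b → (Found n s.mem (r 30) (r 31) (r 32) ∨
        ∀ x < n, ∀ y < n, (x < a ∨ x = a ∧ y < b + 1) → ¬ Candidate n s.mem x y) := by
      refine fun hn => h2.imp_right fun h x hx y hy hxy => ?_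
      by_cases hab : x = a ∧ y = b
      · rw [hab.1, hab.2]; exact hn
      · exact h x hx y hy (by omega)
    refine Runs.seq (Runs.mono (Post := fun s1 t1 => t1 = 14 ∧ s1.mem = s.mem ∧
      (∀ q < 20, s1.reg q = r q) ∧ (∀ q > 25, s1.reg q = r q) ∧
      s1.reg 21 = s.mem (addrM n b b) * s.mem (addrM n a a) * s.mem (addrM n a b) ∧
      s1.reg 24 = s.mem (addrQ n a b) ∧ s1.reg 25 = s.mem (addrQ n a a))
      (Runs.block ?_ ?_) ?_)
    · simp [BlockOk, Instr.value, Instr.apply, c0, c2, h14, h15]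
      simp only [addrM, addrQ] at l1 l2 l3 l4 l5 l6 l7
      omega
    · simp [runBlock, Instr.value, Instr.apply, c0, c2, h14, h15, addrM, addrQ]
      constructor <;> intro q hq <;> simp (disch := omega) only [Function.update_of_ne]
    rintro ⟨r1, m1⟩ t1 ⟨rfl, hm, hr1, hr1', h21, h24, h25⟩
    obtain rfl : m1 = s.mem := hm
    simp only at hr1 hr1' h21 h24 h25
    have d0 : r1 0 = n := by rw [hr1 0 (by norm_num), c0]
    have d1 : r1 1 = 1 := by rw [hr1 1 (by norm_num), c1]
    have d7 : r1 7 = 2 := by rw [hr1 7 (by norm_num), c7]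
    have d14 : r1 14 = a := by rw [hr1 14 (by norm_num), h14]
    have d15 : r1 15 = b := by rw [hr1 15 (by norm_num), h15]
    -- Common to all branches that write nothing; the current pair must then fail to be a candidate.
    have hskip : ∀ t2 ≤ 9, ¬ Candidate n s.mem a b → 14 + t2 ≤ 23 ∧
        (∀ q < 15 + 1, r1 q = r q) ∧ s.mem = s.mem ∧
        (Found n s.mem (r1 30) (r1 31) (r1 32) ∨
          ∀ x < n, ∀ y < n, (x < a ∨ x = a ∧ y < b + 1) → ¬ Candidate n s.mem x y) := by
      intro t2 ht2 hn
      refine ⟨by omega, fun q hq => hr1 q (by omega), rfl, ?_⟩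
      rw [hr1' 30 (by norm_num), hr1' 31 (by norm_num), hr1' 32 (by norm_num)]
      exact hnot hn
    have e1 : Test.Holds ⟨r1, s.mem⟩ (.eq 21 1) ↔ s.mem (addrM n a a) = 1 ∧
        s.mem (addrM n b b) = 1 ∧ s.mem (addrM n a b) = 1 := by
      simp only [Test.Holds, d1, h21, hlive]
    have e2 : Test.Holds ⟨r1, s.mem⟩ (.eq 14 15) ↔ a = b := by simp only [Test.Holds, d14, d15]
    have e3 : Test.Holds ⟨r1, s.mem⟩ (.eq 24 1) ↔ s.mem (addrQ n a b) = 1 := by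
      simp only [Test.Holds, d1, h24]
    have e4 : Test.Holds ⟨r1, s.mem⟩ (.eq 25 7) ↔ s.mem (addrQ n a a) = 2 := by
      simp only [Test.Holds, d7, h25]
    have e5 : Test.Holds ⟨r1, s.mem⟩ (.lt 24 1) ↔ s.mem (addrQ n a b) = 0 := by
      simp only [Test.Holds, d1, h24, Nat.lt_one_iff]
    refine Runs.ite (fun g1 => Runs.ite (fun g2 => Runs.ite (fun g3 => ?_) fun g3 => ?_)
      fun g2 => Runs.ite (fun g3 => ?_) fun g3 => Runs.ite (fun g4 => ?_) fun g4 => ?_)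
      fun g1 => ?_
    · replace g1 := e1.1 g1
      replace g2 := e2.1 g2
      replace g3 := e3.1 g3
      subst g2
      refine Runs.block ?_ ?_
      · simp [BlockOk, Instr.value, Instr.apply, d0, d14]
        omega
      · simp [runBlock, Instr.value, Instr.apply, d0, d14]
        refine ⟨fun q hq => ?_, Or.inl ⟨ha, Or.inl ⟨rfl, rfl, g1.1, g1.1, g1.1, Or.inl ⟨rfl, g3⟩⟩⟩⟩
        simp (disch := omega) only [Function.update_of_ne]
        exact hr1 q (by omega)
    · replace g2 := e2.1 g2
      replace g3 := mt e3.2 g3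
      refine Runs.skip (hskip _ ?_ ?_)
      · norm_num
      rintro ⟨-, -, -, h | h⟩
      · exact g3 h.2
      · exact h.1 g2
    · replace g1 := e1.1 g1
      replace g2 := mt e2.2 g2
      replace g3 := e4.1 g3
      refine Runs.block ?_ ?_
      · simp [BlockOk, Instr.value, Instr.apply, d15, d14]
        omega
      · simp [runBlock, Instr.value, Instr.apply, d15, d14]
        refine ⟨fun q hq => ?_, Or.inl ⟨ha, Or.inr ⟨hb, g2, ⟨g1.1, g1.2.1, g1.2.2,
          Or.inr ⟨g2, Or.inl g3⟩⟩, Or.inl ⟨rfl, g3⟩⟩⟩⟩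
        simp (disch := omega) only [Function.update_of_ne]
        exact hr1 q (by omega)
    · replace g1 := e1.1 g1
      replace g2 := mt e2.2 g2
      replace g3 := mt e4.2 g3
      replace g4 := e5.1 g4
      refine Runs.block ?_ ?_
      · simp [BlockOk, Instr.value, Instr.apply, d15, d14]
        omega
      · simp [runBlock, Instr.value, Instr.apply, d15, d14]
        refine ⟨fun q hq => ?_, Or.inl ⟨ha, Or.inr ⟨hb, g2, ⟨g1.1, g1.2.1, g1.2.2,
          Or.inr ⟨g2, Or.inr g4⟩⟩, Or.inr ⟨rfl, g4⟩⟩⟩⟩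
        simp (disch := omega) only [Function.update_of_ne]
        exact hr1 q (by omega)
    · replace g2 := mt e2.2 g2
      replace g3 := mt e4.2 g3
      replace g4 := mt e5.2 g4
      refine Runs.skip (hskip _ ?_ ?_)
      · norm_num
      rintro ⟨-, -, -, h | ⟨-, h | h⟩⟩
      · exact g2 h.1
      · exact g3 h
      · exact g4 h
    · replace g1 := mt e1.2 g1
      refine Runs.skip (hskip _ ?_ ?_)
      · norm_num
      rintro ⟨h1, h2, h3, -⟩
      exact g1 ⟨h1, h2, h3⟩
  · rintro s' t ⟨ht, hr, hm, hF⟩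
    refine ⟨ht, hr, hm, hF.resolve_right fun h => ?_⟩
    obtain ⟨x, hx, y, hy, hxy⟩ := hex
    exact h x hx y hy (Or.inl hx) hxy

/-! ### Merging cost tables -/

/-- The label after merging a vertex with label `j` into one with label `i` (`d = 1` for pendant
vertices, `d = 2` for twins). -/
def mergeLabel (d i j : ℕ) : ℕ := if d = 1 then i else min (i + j) 3

/-- The closed neighbourhood sum of the vertex that is merged. -/
def mergeSource (d i j k : ℕ) : ℕ := if d = 1 then min (i + j) 3 else k

/-- The closed neighbourhood sum, before the merge, of the vertex that is merged into. -/
def mergeTarget (d j k : ℕ) : ℕ := if d = 1 then min (k + j) 3 else k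

/-- The cost of a pair of entries of the tables of `x` and `y` in a merge. -/
def mergeCost (n : ℕ) (m : ℕ → ℕ) (x y d i j k : ℕ) : ℕ :=
  m (addrA n x j (mergeSource d i j k)) + m (addrA n y i (mergeTarget d j k))

/-- Puts the address of entry `(i, j)` of the cost table of `u` into register `25`. -/
def tableAddr (u i j : ℕ) : List Instr :=
  [.mul 25 u 8, .mul 26 i 4, .add 25 25 26, .add 25 25 j, .add 25 25 3]

/-- Sets the scratch table to the upper bound of all costs. -/
def clearScratch : Program :=
  forLoop 14 4 <| forLoop 15 4 <| block (tableAddr 9 14 15 ++ [.store 25 5])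

/-- Computes the merged table of the vertices in the registers `11` and `12` in the scratch
table. -/
def combine : Program :=
  forLoop 14 4 <| forLoop 15 4 <| forLoop 16 4 <|
    .seq (block [.add 20 14 15, .add 21 16 15]) <|
    .seq (.ite (.lt 6 20) (block [.move 20 6]) .skip) <|
    .seq (.ite (.lt 6 21) (block [.move 21 6]) .skip) <|
    .seq (.ite (.eq 13 1) (block [.move 22 14, .move 23 20, .move 24 21])
      (block [.move 22 20, .move 23 16, .move 24 16])) <|
    .seq (block (tableAddr 11 15 23 ++ [.load 27 25] ++ tableAddr 12 14 24 ++
      [.load 28 25, .add 27 27 28] ++ tableAddr 9 22 16 ++ [.load 28 25])) <|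
    .ite (.lt 27 28) (block [.store 25 27]) .skip

/-- Copies the scratch table to the table of the vertex in register `12`. -/
def copyScratch : Program :=
  forLoop 14 4 <| forLoop 15 4 <|
    block (tableAddr 9 14 15 ++ [.load 27 25] ++ tableAddr 12 14 15 ++ [.store 25 27])

/-- Merges the cost table of the vertex in register `11` into that of the vertex in register
`12`. -/
def merge : Program := .seq clearScratch (.seq combine copyScratch)

theorem runs_clearScratch {n W : ℕ} {s : State} (hs : Consts n s)
    (hW : 2 * (n * n) + 100 * n + 100 ≤ W) :
    Runs W clearScratch s fun s' t => t ≤ 200 ∧ (∀ q < 14, s'.reg q = s.reg q) ∧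
      (∀ x < n, ∀ y < n, s'.mem (addrM n x y) = s.mem (addrM n x y)) ∧
      (∀ x < n, ∀ y < n, s'.mem (addrQ n x y) = s.mem (addrQ n x y)) ∧
      (∀ u ≤ n, ∀ i < 4, ∀ j < 4, s'.mem (addrA n u i j) = s.mem (addrA n u i j)) ∧
      (∀ i < 4, ∀ j < 4, s'.mem (addrA n (n + 1) i j) = 2 * n + 3) := by
  refine (Runs.of_forLoop₂ (T := 6) (N := 4) (N' := 4) (fun a b s' =>
    (∀ x < n, ∀ y < n, s'.mem (addrM n x y) = s.mem (addrM n x y)) ∧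
    (∀ x < n, ∀ y < n, s'.mem (addrQ n x y) = s.mem (addrQ n x y)) ∧
    (∀ u ≤ n, ∀ i < 4, ∀ j < 4, s'.mem (addrA n u i j) = s.mem (addrA n u i j)) ∧
    (∀ i < 4, ∀ j < 4, (i < a ∨ i = a ∧ j < b) → s'.mem (addrA n (n + 1) i j) = 2 * n + 3))
    (by norm_num) (by norm_num) (by norm_num) (by norm_num) hs.r4 hs.r4 hs.r1 (by omega)
    (by omega) (fun _ _ _ _ h => h) (fun _ _ _ _ h => h) ?_ ?_ ?_).mono ?_
  · simp
  · rintro a ha s' ⟨h1, h2, h3, h4⟩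
    exact ⟨h1, h2, h3, fun i hi j hj h => h4 i hi j hj (by omega)⟩
  · rintro a ha b hb ⟨r, m⟩ hr h14 h15 ⟨h1, h2, h3, h4⟩
    have hc : Consts n ⟨r, m⟩ := hs.congr fun q hq => hr q (by omega)
    obtain ⟨c0, c1, c2, c3, c4, c5, c6, c7, c8, c9⟩ := hc
    simp only at c3 c4 c5 c8 c9 h14 h15 h1 h2 h3 h4
    refine Runs.block ?_ ?_
    · simp [tableAddr, BlockOk, Instr.value, Instr.apply, c3, c4, c5, c8, c9, h14, h15]
      omega
    · simp [tableAddr, runBlock, Instr.value, Instr.apply, c3, c4, c5, c8, c9, h14, h15]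
      rw [show (n + 1) * 16 + a * 4 + b + (n * n + n * n) = addrA n (n + 1) a b from rfl]
      refine ⟨fun q hq => ?_, fun x hx y hy => ?_, fun x hx y hy => ?_,
        fun u hu i hi j hj => ?_, fun i hi j hj h => ?_⟩
      · simp (disch := omega) only [Function.update_of_ne]
      · rw [update_addrA_addrM hx hy, h1 x hx y hy]
      · rw [update_addrA_addrQ hx hy, h2 x hx y hy]
      · rw [update_addrA_addrA ha hb hi hj, if_neg (by omega), h3 u hu i hi j hj]
      · rw [update_addrA_addrA ha hb hi hj]
        split_ifs with hif
        · rfl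
        · exact h4 i hi j hj (by omega)
  · rintro s' t ⟨ht, hr, h1, h2, h3, h4⟩
    exact ⟨by omega, hr, h1, h2, h3, fun i hi j hj => h4 i hi j hj (Or.inl hi)⟩

theorem runs_copyScratch {n W y : ℕ} {s : State} (hs : Consts n s)
    (hW : 2 * (n * n) + 100 * n + 100 ≤ W) (hy : y ≤ n) (h12 : s.reg 12 = y)
    (hA : ∀ i < 4, ∀ j < 4, s.mem (addrA n (n + 1) i j) ≤ 2 * n + 3) :
    Runs W copyScratch s fun s' t => t ≤ 300 ∧ (∀ q < 14, s'.reg q = s.reg q) ∧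
      (∀ x < n, ∀ y < n, s'.mem (addrM n x y) = s.mem (addrM n x y)) ∧
      (∀ x < n, ∀ y < n, s'.mem (addrQ n x y) = s.mem (addrQ n x y)) ∧
      (∀ u ≤ n, u ≠ y → ∀ i < 4, ∀ j < 4, s'.mem (addrA n u i j) = s.mem (addrA n u i j)) ∧
      (∀ i < 4, ∀ j < 4, s'.mem (addrA n y i j) = s.mem (addrA n (n + 1) i j)) := by
  refine (Runs.of_forLoop₂ (T := 12) (N := 4) (N' := 4) (fun a b s' =>
    (∀ x < n, ∀ y < n, s'.mem (addrM n x y) = s.mem (addrM n x y)) ∧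
    (∀ x < n, ∀ y < n, s'.mem (addrQ n x y) = s.mem (addrQ n x y)) ∧
    (∀ u, u ≠ y → ∀ i < 4, ∀ j < 4, s'.mem (addrA n u i j) = s.mem (addrA n u i j)) ∧
    (∀ i < 4, ∀ j < 4, (i < a ∨ i = a ∧ j < b) →
      s'.mem (addrA n y i j) = s.mem (addrA n (n + 1) i j)))
    (by norm_num) (by norm_num) (by norm_num) (by norm_num) hs.r4 hs.r4 hs.r1 (by omega)
    (by omega) (fun _ _ _ _ h => h) (fun _ _ _ _ h => h) ?_ ?_ ?_).mono ?_
  · simp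
  · rintro a ha s' ⟨h1, h2, h3, h4⟩
    exact ⟨h1, h2, h3, fun i hi j hj h => h4 i hi j hj (by omega)⟩
  · rintro a ha b hb ⟨r, m⟩ hr h14 h15 ⟨h1, h2, h3, h4⟩
    have hc : Consts n ⟨r, m⟩ := hs.congr fun q hq => hr q (by omega)
    obtain ⟨c0, c1, c2, c3, c4, c5, c6, c7, c8, c9⟩ := hc
    rw [← hr 12 (by norm_num)] at h12
    simp only at c3 c4 c8 c9 h12 h14 h15 h1 h2 h3 h4
    have e1 : m (addrA n (n + 1) a b) = s.mem (addrA n (n + 1) a b) :=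
      h3 _ (by omega) a ha b hb
    have l1 := hA a ha b hb
    rw [← e1] at l1
    refine Runs.block ?_ ?_
    · simp [tableAddr, BlockOk, Instr.value, Instr.apply, c3, c4, c8, c9, h12, h14, h15]
      unfold addrA at l1
      omega
    · simp [tableAddr, runBlock, Instr.value, Instr.apply, c3, c4, c8, c9, h12, h14, h15]
      rw [show (n + 1) * 16 + a * 4 + b + (n * n + n * n) = addrA n (n + 1) a b from rfl,
        show y * 16 + a * 4 + b + (n * n + n * n) = addrA n y a b from rfl]
      refine ⟨fun q hq => ?_, fun x hx y hy => ?_, fun x hx y hy => ?_,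
        fun u hu i hi j hj => ?_, fun i hi j hj h => ?_⟩
      · simp (disch := omega) only [Function.update_of_ne]
      · rw [update_addrA_addrM hx hy, h1 x hx y hy]
      · rw [update_addrA_addrQ hx hy, h2 x hx y hy]
      · rw [update_addrA_addrA ha hb hi hj, if_neg (by tauto), h3 u hu i hi j hj]
      · rw [update_addrA_addrA ha hb hi hj]
        split_ifs with hif
        · rw [hif.2.1, hif.2.2, e1]
        · exact h4 i hi j hj (by omega)
  · rintro s' t ⟨ht, hr, h1, h2, h3, h4⟩
    exact ⟨by omega, hr, h1, h2, fun u _ => h3 u, fun i hi j hj => h4 i hi j hj (Or.inl hi)⟩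

/-- The properties of the scratch table after the triples satisfying `P` have been processed. -/
def Combined (n : ℕ) (m0 m : ℕ → ℕ) (x y d : ℕ) (P : ℕ → ℕ → ℕ → Prop) : Prop :=
  (∀ p < 4, ∀ k < 4, m (addrA n (n + 1) p k) ≤ 2 * n + 3) ∧
  (∀ i < 4, ∀ j < 4, ∀ k < 4, P i j k →
    m (addrA n (n + 1) (mergeLabel d i j) k) ≤ mergeCost n m0 x y d i j k) ∧
  (∀ p < 4, ∀ k < 4, 2 * n + 3 ≤ m (addrA n (n + 1) p k) ∨ ∃ i < 4, ∃ j < 4,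
    mergeLabel d i j = p ∧ mergeCost n m0 x y d i j k ≤ m (addrA n (n + 1) p k))

theorem Combined.mono {n x y d : ℕ} {m0 m : ℕ → ℕ} {P P' : ℕ → ℕ → ℕ → Prop}
    (h : Combined n m0 m x y d P) (hP : ∀ i < 4, ∀ j < 4, ∀ k < 4, P' i j k → P i j k) :
    Combined n m0 m x y d P' :=
  ⟨h.1, fun i hi j hj k hk hp => h.2.1 i hi j hj k hk (hP i hi j hj k hk hp), h.2.2⟩

theorem mergeLabel_lt {d i j : ℕ} (hi : i < 4) : mergeLabel d i j < 4 := by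
  unfold mergeLabel
  split_ifs <;> omega

theorem mergeSource_lt {d i j k : ℕ} (hk : k < 4) : mergeSource d i j k < 4 := by
  unfold mergeSource
  split_ifs <;> omega

theorem mergeTarget_lt {d j k : ℕ} (hk : k < 4) : mergeTarget d j k < 4 := by
  unfold mergeTarget
  split_ifs <;> omega

/-- Processing the triple `(i, j, k)`. -/
theorem Combined.step {n x y d i j k : ℕ} {m0 m m' : ℕ → ℕ} {P P' : ℕ → ℕ → ℕ → Prop}
    (h : Combined n m0 m x y d P) (hi : i < 4) (hj : j < 4) (hk : k < 4)
    (hP : ∀ i' < 4, ∀ j' < 4, ∀ k' < 4, P' i' j' k' → P i' j' k' ∨ (i' = i ∧ j' = j ∧ k' = k))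
    (hm : ∀ p < 4, ∀ q < 4, m' (addrA n (n + 1) p q) =
      if p = mergeLabel d i j ∧ q = k
      then min (m (addrA n (n + 1) p q)) (mergeCost n m0 x y d i j k)
      else m (addrA n (n + 1) p q)) :
    Combined n m0 m' x y d P' := by
  obtain ⟨h1, h2, h3⟩ := h
  have hle : ∀ p < 4, ∀ q < 4, m' (addrA n (n + 1) p q) ≤ m (addrA n (n + 1) p q) := by
    intro p hp q hq
    rw [hm p hp q hq]
    split_ifs
    · exact min_le_left _ _
    · exact le_rfl
  refine ⟨fun p hp q hq => (hle p hp q hq).trans (h1 p hp q hq), fun i' hi' j' hj' k' hk' hp => ?_,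
    fun p hp q hq => ?_⟩
  · rcases hP i' hi' j' hj' k' hk' hp with hp | ⟨rfl, rfl, rfl⟩
    · exact (hle _ (mergeLabel_lt hi') _ hk').trans (h2 i' hi' j' hj' k' hk' hp)
    · rw [hm _ (mergeLabel_lt hi') _ hk', if_pos ⟨rfl, rfl⟩]
      exact min_le_right _ _
  · rw [hm p hp q hq]
    split_ifs with hif
    · rcases min_choice (m (addrA n (n + 1) p q)) (mergeCost n m0 x y d i j k) with h | h
      · rw [h]; exact h3 p hp q hq
      · rw [h]
        exact Or.inr ⟨i, hi, j, hj, hif.1.symm, by rw [hif.2]⟩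
    · exact h3 p hp q hq

/-- The minimum is formed in the scratch table `n + 1` because the table of `y` is still being read.
Starting at `2 * n + 3` caps the result, so entries do not grow from merge to merge. -/
theorem runs_combine {n W x y d : ℕ} {s : State} (hs : Consts n s)
    (hW : 2 * (n * n) + 100 * n + 100 ≤ W) (hx : x < n) (hy : y ≤ n)
    (h11 : s.reg 11 = x) (h12 : s.reg 12 = y) (h13 : s.reg 13 = d)
    (hA : ∀ u ≤ n, ∀ i < 4, ∀ j < 4, s.mem (addrA n u i j) ≤ 2 * n + 3)
    (hT : ∀ i < 4, ∀ j < 4, s.mem (addrA n (n + 1) i j) = 2 * n + 3) :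
    Runs W combine s fun s' t => t ≤ 5000 ∧ (∀ q < 14, s'.reg q = s.reg q) ∧
      (∀ x < n, ∀ y < n, s'.mem (addrM n x y) = s.mem (addrM n x y)) ∧
      (∀ x < n, ∀ y < n, s'.mem (addrQ n x y) = s.mem (addrQ n x y)) ∧
      (∀ u ≤ n, ∀ i < 4, ∀ j < 4, s'.mem (addrA n u i j) = s.mem (addrA n u i j)) ∧
      Combined n s.mem s'.mem x y d fun _ _ _ => True := by
  let I : (ℕ → ℕ → ℕ → Prop) → State → Prop := fun P s' =>
    (∀ x < n, ∀ y < n, s'.mem (addrM n x y) = s.mem (addrM n x y)) ∧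
    (∀ x < n, ∀ y < n, s'.mem (addrQ n x y) = s.mem (addrQ n x y)) ∧
    (∀ u ≤ n, ∀ i < 4, ∀ j < 4, s'.mem (addrA n u i j) = s.mem (addrA n u i j)) ∧
    Combined n s.mem s'.mem x y d P
  have hI : ∀ P P' s', (∀ i < 4, ∀ j < 4, ∀ k < 4, P' i j k → P i j k) → I P s' → I P' s' :=
    fun P P' s' h hP => ⟨hP.1, hP.2.1, hP.2.2.1, hP.2.2.2.mono h⟩
  refine (Runs.of_forLoop (T := 800) (N := 4) (fun a => I fun i _ _ => i < a)
    (by norm_num) (by norm_num) hs.r4 hs.r1 (by omega) (fun _ _ _ h => h) ?_ ?_).mono ?_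
  · refine ⟨by simp, by simp, by simp, fun p hp k hk => (hT p hp k hk).le, by simp,
      fun p hp k hk => Or.inl (hT p hp k hk).ge⟩
  · intro a ha s1 hr1 h14 hI1
    have hc1 : Consts n s1 := hs.congr fun q hq => hr1 q (by omega)
    refine (Runs.of_forLoop₂ (T := 37) (N := 4) (N' := 4)
      (fun b c => I fun i j k => i < a ∨ i = a ∧ (j < b ∨ j = b ∧ k < c))
      (by norm_num) (by norm_num) (by norm_num) (by norm_num) hc1.r4 hc1.r4 hc1.r1 (by omega)
      (by omega) (fun _ _ _ _ h => h) (fun _ _ _ _ h => h) (hI _ _ _ ?_ hI1) ?_ ?_).mono ?_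
    · omega
    · exact fun b hb s2 h => hI _ _ _ (by omega) h
    · rintro b hb c hc ⟨r, m⟩ hr h15 h16 ⟨h1, h2, h3, h4⟩
      have hcs : Consts n ⟨r, m⟩ := hc1.congr fun q hq => hr q (by omega)
      obtain ⟨c0, c1, c2, c3, c4, c5, c6, c7, c8, c9⟩ := hcs
      rw [← hr1 11 (by norm_num), ← hr 11 (by norm_num)] at h11
      rw [← hr1 12 (by norm_num), ← hr 12 (by norm_num)] at h12
      rw [← hr1 13 (by norm_num), ← hr 13 (by norm_num)] at h13
      rw [← hr 14 (by norm_num)] at h14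
      simp only at c1 c3 c4 c6 c8 c9 h11 h12 h13 h14 h15 h16 h1 h2 h3 h4
      have hml : mergeLabel d a b < 4 := mergeLabel_lt ha
      have hms : mergeSource d a b c < 4 := mergeSource_lt hc
      have hmt : mergeTarget d b c < 4 := mergeTarget_lt hc
      have e1 := h3 x (by omega) b hb _ hms
      have e2 := h3 y hy a ha _ hmt
      have l1 := hA x (by omega) b hb _ hms
      have l2 := hA y hy a ha _ hmt
      have l3 := h4.1 _ hml c hc
      rw [← e1] at l1
      rw [← e2] at l2
      refine Runs.seq (Runs.block ?_ ?_)
      · simp [BlockOk, Instr.value, Instr.apply, h14, h15, h16]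
        omega
      refine Runs.seq (Runs.mono (Post := fun s1 t1 => t1 ≤ 2 ∧ s1.mem = m ∧
        (∀ q < 20, s1.reg q = r q) ∧ s1.reg 20 = min (a + b) 3 ∧ s1.reg 21 = c + b)
        (Runs.ite (fun g => Runs.block ?_ ?_) fun g => Runs.skip ?_) ?_)
      all_goals try simp [BlockOk, runBlock, Test.Holds, Instr.value, Instr.apply, c6, h14, h15,
        h16] at g ⊢
      · omega
      · exact ⟨fun q hq => by simp (disch := omega) only [Function.update_of_ne], by omega⟩
      · exact ⟨fun q hq => by simp (disch := omega) only [Function.update_of_ne], by omega⟩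
      rintro ⟨r1, m1⟩ t1 ⟨ht1, hm, k1, k20, k21⟩
      obtain rfl : m1 = m := hm
      simp only at k1 k20 k21
      refine Runs.seq (Runs.mono (Post := fun s1 t1 => t1 ≤ 2 ∧ s1.mem = m1 ∧
        (∀ q < 20, s1.reg q = r q) ∧ s1.reg 20 = min (a + b) 3 ∧ s1.reg 21 = min (c + b) 3)
        (Runs.ite (fun g => Runs.block ?_ ?_) fun g => Runs.skip ?_) ?_)
      all_goals try simp [BlockOk, runBlock, Test.Holds, Instr.value, Instr.apply,
        (k1 6 (by norm_num)).trans c6, k20, k21] at g ⊢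
      · omega
      · refine ⟨fun q hq => ?_, by omega⟩
        simp (disch := omega) only [Function.update_of_ne]
        exact k1 q hq
      · exact ⟨k1, by omega⟩
      rintro ⟨r2, m2⟩ t2 ⟨ht2, hm, k1', k20', k21'⟩
      obtain rfl : m2 = m1 := hm
      simp only at k1' k20' k21'
      refine Runs.seq (Runs.mono (Post := fun s1 t1 => t1 ≤ 4 ∧ s1.mem = m2 ∧
        (∀ q < 20, s1.reg q = r q) ∧ s1.reg 22 = mergeLabel d a b ∧
        s1.reg 23 = mergeSource d a b c ∧ s1.reg 24 = mergeTarget d b c)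
        (Runs.ite (fun g => Runs.block ?_ ?_) fun g => Runs.block ?_ ?_) ?_)
      all_goals try simp [BlockOk, runBlock, Test.Holds, Instr.value, Instr.apply,
        (k1' 1 (by norm_num)).trans c1, (k1' 13 (by norm_num)).trans h13,
        (k1' 14 (by norm_num)).trans h14, (k1' 16 (by norm_num)).trans h16, k20', k21'] at g ⊢
      · omega
      · refine ⟨fun q hq => ?_, ?_⟩
        · simp (disch := omega) only [Function.update_of_ne]
          exact k1' q hq
        · simp [mergeLabel, mergeSource, mergeTarget, g]
      · omega
      · refine ⟨fun q hq => ?_, ?_⟩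
        · simp (disch := omega) only [Function.update_of_ne]
          exact k1' q hq
        · simp [mergeLabel, mergeSource, mergeTarget, g]
      rintro ⟨r3, m3⟩ t3 ⟨ht3, hm, k1'', k22, k23, k24⟩
      obtain rfl : m3 = m2 := hm
      simp only at k1'' k22 k23 k24
      have d3 := (k1'' 3 (by norm_num)).trans c3
      have d4 := (k1'' 4 (by norm_num)).trans c4
      have d8 := (k1'' 8 (by norm_num)).trans c8
      have d9 := (k1'' 9 (by norm_num)).trans c9
      have d11 := (k1'' 11 (by norm_num)).trans h11
      have d12 := (k1'' 12 (by norm_num)).trans h12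
      have d14 := (k1'' 14 (by norm_num)).trans h14
      have d15 := (k1'' 15 (by norm_num)).trans h15
      have d16 := (k1'' 16 (by norm_num)).trans h16
      have hcost : m3 (addrA n x b (mergeSource d a b c)) + m3 (addrA n y a (mergeTarget d b c)) =
          mergeCost n s.mem x y d a b c := by rw [e1, e2]; rfl
      refine Runs.seq (Runs.mono (Post := fun s1 t1 => t1 = 19 ∧ s1.mem = m3 ∧
        (∀ q < 20, s1.reg q = r q) ∧ s1.reg 25 = addrA n (n + 1) (mergeLabel d a b) c ∧
        s1.reg 27 = mergeCost n s.mem x y d a b c ∧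
        s1.reg 28 = m3 (addrA n (n + 1) (mergeLabel d a b) c))
        (Runs.block ?_ ?_) ?_)
      · simp [tableAddr, BlockOk, Instr.value, Instr.apply, d3, d4, d8, d9, d11, d12, d14, d15, d16,
          k22, k23, k24]
        unfold addrA at l1 l2 l3
        omega
      · simp [tableAddr, runBlock, Instr.value, Instr.apply, d3, d4, d8, d9, d11, d12, d14, d15,
          d16, k22, k23, k24]
        refine ⟨fun q hq => ?_, rfl, hcost, rfl⟩
        simp (disch := omega) only [Function.update_of_ne]
        exact k1'' q hq
      rintro ⟨r4, m4⟩ t4 ⟨rfl, hm, f1, f25, f27, f28⟩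
      obtain rfl : m4 = m3 := hm
      simp only at f1 f25 f27 f28
      refine Runs.ite (fun g => Runs.block ?_ ?_) fun g => Runs.skip ?_
      all_goals simp [BlockOk, runBlock, Test.Holds, Instr.value, Instr.apply, f25, f27, f28]
          at g ⊢
      · omega
      · refine ⟨by omega, fun q hq => f1 q (by omega), fun x hx y hy => ?_, fun x hx y hy => ?_,
          fun u hu i hi j hj => ?_, h4.step ha hb hc ?_ fun p hp q hq => ?_⟩
        · exact (update_addrA_addrM hx hy).trans (h1 x hx y hy)
        · exact (update_addrA_addrQ hx hy).trans (h2 x hx y hy)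
        · exact (update_addrA_addrA hml hc hi hj).trans
            ((if_neg (by omega)).trans (h3 u hu i hi j hj))
        · omega
        · refine (update_addrA_addrA hml hc hp hq).trans ?_
          by_cases hpq : p = mergeLabel d a b ∧ q = c
          · rw [if_pos ⟨rfl, hpq⟩, if_pos hpq, hpq.1, hpq.2, min_eq_right g.le]
          · rw [if_neg (by tauto), if_neg hpq]
      · refine ⟨by omega, fun q hq => f1 q (by omega), h1, h2, h3,
          h4.step ha hb hc ?_ fun p hp q hq => ?_⟩
        · omega
        · by_cases hpq : p = mergeLabel d a b ∧ q = c
          · rw [if_pos hpq, hpq.1, hpq.2, min_eq_left g]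
          · rw [if_neg hpq]
    · rintro s2 t ⟨ht, hr2, hI2⟩
      exact ⟨by omega, hr2, hI _ _ _ (by omega) hI2⟩
  · rintro s' t ⟨ht, hr, h1, h2, h3, h4⟩
    exact ⟨by omega, hr, h1, h2, h3, h4.mono fun i hi _ _ _ _ _ => hi⟩

/-- The last two clauses, a lower bound on all prices and their attainment below the cap, are the
hypotheses `hle` and `hge` of the elimination lemmas for `B = 2 * n + 3`. -/
theorem runs_merge {n W x y d : ℕ} {s : State} (hs : Consts n s)
    (hW : 2 * (n * n) + 100 * n + 100 ≤ W) (hx : x < n) (hy : y ≤ n)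
    (h11 : s.reg 11 = x) (h12 : s.reg 12 = y) (h13 : s.reg 13 = d)
    (hA : ∀ u ≤ n, ∀ i < 4, ∀ j < 4, s.mem (addrA n u i j) ≤ 2 * n + 3) :
    Runs W merge s fun s' t => t ≤ 5500 ∧ (∀ q < 14, s'.reg q = s.reg q) ∧
      (∀ x < n, ∀ y < n, s'.mem (addrM n x y) = s.mem (addrM n x y)) ∧
      (∀ x < n, ∀ y < n, s'.mem (addrQ n x y) = s.mem (addrQ n x y)) ∧
      (∀ u ≤ n, u ≠ y → ∀ i < 4, ∀ j < 4, s'.mem (addrA n u i j) = s.mem (addrA n u i j)) ∧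
      (∀ p < 4, ∀ k < 4, s'.mem (addrA n y p k) ≤ 2 * n + 3) ∧
      (∀ i < 4, ∀ j < 4, ∀ k < 4,
        s'.mem (addrA n y (mergeLabel d i j) k) ≤ mergeCost n s.mem x y d i j k) ∧
      (∀ p < 4, ∀ k < 4, 2 * n + 3 ≤ s'.mem (addrA n y p k) ∨ ∃ i < 4, ∃ j < 4,
        mergeLabel d i j = p ∧ mergeCost n s.mem x y d i j k ≤ s'.mem (addrA n y p k)) := by
  refine Runs.seq ((runs_clearScratch hs hW).mono ?_)
  rintro s1 t1 ⟨ht1, hr1, hM1, hQ1, hA1, hT1⟩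
  refine Runs.seq ((runs_combine (hs.congr fun q hq => hr1 q (by omega)) hW hx hy
    ((hr1 11 (by norm_num)).trans h11) ((hr1 12 (by norm_num)).trans h12)
    ((hr1 13 (by norm_num)).trans h13)
    (fun u hu i hi j hj => by rw [hA1 u hu i hi j hj]; exact hA u hu i hi j hj) hT1).mono ?_)
  rintro s2 t2 ⟨ht2, hr2, hM2, hQ2, hA2, hC1, hC2, hC3⟩
  have hcost : ∀ i < 4, ∀ j < 4, ∀ k < 4,
      mergeCost n s1.mem x y d i j k = mergeCost n s.mem x y d i j k := by
    intro i hi j hj k hk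
    unfold mergeCost
    rw [hA1 x (by omega) j hj _ (mergeSource_lt hk), hA1 y hy i hi _ (mergeTarget_lt hk)]
  refine (runs_copyScratch (y := y) (hs.congr fun q hq => (hr2 q (by omega)).trans
    (hr1 q (by omega))) hW hy
    ((hr2 12 (by norm_num)).trans ((hr1 12 (by norm_num)).trans h12)) hC1).mono ?_
  rintro s3 t3 ⟨ht3, hr3, hM3, hQ3, hA3, hA3'⟩
  refine ⟨by omega, fun q hq => (hr3 q hq).trans ((hr2 q hq).trans (hr1 q hq)),
    fun x hx y hy => (hM3 x hx y hy).trans ((hM2 x hx y hy).trans (hM1 x hx y hy)),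
    fun x hx y hy => (hQ3 x hx y hy).trans ((hQ2 x hx y hy).trans (hQ1 x hx y hy)),
    fun u hu huy i hi j hj => (hA3 u hu huy i hi j hj).trans
      ((hA2 u hu i hi j hj).trans (hA1 u hu i hi j hj)),
    fun p hp k hk => ?_, fun i hi j hj k hk => ?_, fun p hp k hk => ?_⟩
  · rw [hA3' p hp k hk]; exact hC1 p hp k hk
  · rw [hA3' _ (mergeLabel_lt hi) k hk, ← hcost i hi j hj k hk]
    exact hC2 i hi j hj k hk trivial
  · rw [hA3' p hp k hk]
    refine (hC3 p hp k hk).imp_right ?_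
    rintro ⟨i, hi, j, hj, h1, h2⟩
    exact ⟨i, hi, j, hj, h1, by rwa [← hcost i hi j hj k hk]⟩

end RAM

open Classical in
theorem distCount_le_card {V : Type*} (c : V → V → Prop) (U : Finset V) (x y : V) :
    distCount c U x y ≤ U.card := by
  unfold distCount
  exact Finset.card_filter_le _ _

/-! ### The invariant of the elimination loop -/

namespace RAM

open Classical in
/-- The meaning of the memory when the vertices in `U` are left. -/
structure Invariant {n : ℕ} (G : SimpleGraph (Fin n)) (U : Finset ℕ) (m : ℕ → ℕ) : Prop where
  subset : ∀ x ∈ U, x < n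
  adj : ∀ x < n, ∀ y < n, m (addrM n x y) =
    if x = y ∧ x ∈ U ∨ x ≠ y ∧ closedAdj G x y then 1 else 0
  -- Counts that involve deleted vertices carry no meaning and are only bounded, by `count_le`.
  count : ∀ x ∈ U, ∀ y ∈ U, m (addrQ n x y) = distCount (closedAdj G) U x y
  count_le : ∀ x < n, ∀ y < n, m (addrQ n x y) ≤ n
  table_le : ∀ u ≤ n, ∀ i < 4, ∀ j < 4, m (addrA n u i j) ≤ 2 * n + 3
  -- Row 0 of the dummy table stores the additive constant in every column.
  dummy : ∀ k < 4, m (addrA n n 0 k) = m (addrA n n 0 0)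
  opt : IsOptimum (closedAdj G) U (fun u i j => m (addrA n u i j)) (m (addrA n n 0 0)) (gammaR3 G)

section Invariant

variable {n : ℕ} {G : SimpleGraph (Fin n)} {U : Finset ℕ} {m m' : ℕ → ℕ} {x y d : ℕ}

theorem Invariant.adj_le (h : Invariant G U m) (hx : x < n) (hy : y < n) :
    m (addrM n x y) ≤ 1 := by
  rw [h.adj x hx y hy]
  split_ifs <;> norm_num

theorem Invariant.self_eq_one (h : Invariant G U m) (hx : x < n) :
    m (addrM n x x) = 1 ↔ x ∈ U := by
  rw [h.adj x hx x hx]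
  simp

theorem Invariant.ne_eq_one (h : Invariant G U m) (hx : x < n) (hy : y < n) (hxy : x ≠ y) :
    m (addrM n x y) = 1 ↔ closedAdj G x y := by
  rw [h.adj x hx y hy]
  simp [hxy]

theorem Invariant.adj_of_mem (h : Invariant G U m) (hx : x ∈ U) (hy : y < n) :
    m (addrM n x y) = 1 ↔ closedAdj G x y := by
  by_cases hxy : x = y
  · subst hxy
    exact (h.self_eq_one hy).trans (iff_of_true hx (Or.inl rfl))
  · exact h.ne_eq_one (h.subset x hx) hy hxy

theorem Invariant.exists_candidate (h : Invariant G U m) (hG : IsBlockGraph G)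
    (hU : U.Nonempty) : ∃ x < n, ∃ y < n, Candidate n m x y := by
  obtain ⟨x, y, hx, hy, hxy, hc⟩ := exists_eliminable hG hU
  have hxn := h.subset x hx
  have hyn := h.subset y hy
  refine ⟨x, hxn, y, hyn, (h.self_eq_one hxn).2 hx, (h.self_eq_one hyn).2 hy,
    (h.adj_of_mem hx hyn).2 hxy, ?_⟩
  rw [h.count x hx y hy, h.count x hx x hx]
  rcases hc with ⟨rfl, hc⟩ | hc
  · exact Or.inl ⟨rfl, hc⟩
  · exact Or.inr hc

theorem Invariant.mem_of_found (h : Invariant G U m) (hf : Found n m x y d) : x ∈ U := by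
  obtain ⟨hx, ⟨-, -, hc⟩ | ⟨-, -, hc, -⟩⟩ := hf
  · exact (h.self_eq_one hx).1 hc.1
  · exact (h.self_eq_one hx).1 hc.1

/-- The tables after the elimination of `x` describe an equivalent problem. -/
theorem Invariant.eliminate (h : Invariant G U m) (hf : Found n m x y d)
    (hA : ∀ u ≤ n, u ≠ y → ∀ i < 4, ∀ j < 4, m' (addrA n u i j) = m (addrA n u i j))
    (hB : ∀ p < 4, ∀ k < 4, m' (addrA n y p k) ≤ 2 * n + 3)
    (hle : ∀ i < 4, ∀ j < 4, ∀ k < 4,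
      m' (addrA n y (mergeLabel d i j) k) ≤ mergeCost n m x y d i j k)
    (hge : ∀ p < 4, ∀ k < 4, 2 * n + 3 ≤ m' (addrA n y p k) ∨ ∃ i < 4, ∃ j < 4,
      mergeLabel d i j = p ∧ mergeCost n m x y d i j k ≤ m' (addrA n y p k)) :
    (∀ k < 4, m' (addrA n n 0 k) = m' (addrA n n 0 0)) ∧
    IsOptimum (closedAdj G) (U.erase x) (fun u i j => m' (addrA n u i j))
      (m' (addrA n n 0 0)) (gammaR3 G) := by
  -- The constant labelling 2 gives `2 * n`; the extra 3 makes room for the initial table entries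
  -- when `n` is small.
  have hγ : gammaR3 G ≤ 2 * n + 3 := (gammaR3_le G).trans (by omega)
  have hxU := h.mem_of_found hf
  have hr : closedAdj G x x := Or.inl rfl
  obtain ⟨hx, ⟨rfl, rfl, hc⟩ | ⟨hy, hxy, hc, hd⟩⟩ := hf
  · have hone : m (addrQ y x x) = 1 := by
      rcases hc.2.2.2 with h | h
      · exact h.2
      · exact absurd rfl h.1
    rw [h.count x hxU x hxU, distCount_self_eq_one hxU hr] at hone
    -- An isolated vertex is merged like a pendant vertex at the dummy with label 0: `x` then sees
    -- only its own label, and the shifted column is harmless because row 0 is constant.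
    have hcost : ∀ j < 4, ∀ k < 4, mergeCost y m x y 1 0 j k =
        m (addrA y x j j) + m (addrA y y 0 0) := by
      intro j hj k hk
      simp only [mergeCost, mergeSource, mergeTarget, if_true, zero_add]
      rw [min_eq_left (by omega), h.dummy _ (by omega)]
    -- The prices that are minimised do not depend on the column, so row 0 stays constant.
    have hdummy : ∀ k < 4, ∀ k' < 4, m' (addrA y y 0 k) ≤ m' (addrA y y 0 k') := by
      intro k hk k' hk'
      rcases hge 0 (by norm_num) k' hk' with h1 | ⟨i, hi, j, hj, hij, h1⟩
      · exact (hB 0 (by norm_num) k hk).trans h1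
      · obtain rfl : i = 0 := by simpa [mergeLabel] using hij
        have h2 := hle 0 (by norm_num) j hj k hk
        rw [hcost j hj k hk] at h2
        rw [hcost j hj k' hk'] at h1
        exact h2.trans h1
    refine ⟨fun k hk => le_antisymm (hdummy k hk 0 (by norm_num)) (hdummy 0 (by norm_num) k hk),
      h.opt.isolated hγ hxU (fun u hu => closedAdj_comm.trans (hone u hu)) hone
        (fun u hu _ p hp q hq => hA u (h.subset u hu).le (h.subset u hu).ne p (by omega) q
          (by omega)) (fun j hj => ?_) ?_⟩
    · have := hle 0 (by norm_num) j (by omega) 0 (by norm_num)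
      rwa [hcost j (by omega) 0 (by norm_num)] at this
    · refine (hge 0 (by norm_num) 0 (by norm_num)).imp_right ?_
      rintro ⟨i, hi, j, hj, hij, h1⟩
      obtain rfl : i = 0 := by simpa [mergeLabel] using hij
      rw [hcost j hj 0 (by norm_num)] at h1
      exact ⟨j, by omega, h1⟩
  · have hyU : y ∈ U := (h.self_eq_one hy).1 hc.2.1
    have hcxy : closedAdj G x y := (h.ne_eq_one hx hy hxy).1 hc.2.2.1
    -- Here `y < n`, so the merge does not touch the constant.
    have hdum : ∀ k < 4, m' (addrA n n 0 k) = m (addrA n n 0 k) := fun k hk =>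
      hA n le_rfl hy.ne' 0 (by norm_num) k hk
    refine ⟨fun k hk => by rw [hdum k hk, hdum 0 (by norm_num), h.dummy k hk], ?_⟩
    rw [hdum 0 (by norm_num)]
    have hA' : ∀ u ∈ U, u ≠ x → u ≠ y → ∀ p ≤ 3, ∀ q ≤ 3,
        m' (addrA n u p q) = m (addrA n u p q) := fun u hu _ huy p hp q hq =>
      hA u (h.subset u hu).le huy p (by omega) q (by omega)
    rcases hd with ⟨rfl, hd⟩ | ⟨rfl, hd⟩
    · rw [h.count x hxU x hxU, distCount_self_eq_two hxU hyU hxy hr hcxy] at hd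
      refine h.opt.pendant hγ hxU hyU hxy (fun u hu => closedAdj_comm.trans (hd u hu)) hd hA'
        (fun i hi j hj k hk => hle i (by omega) j (by omega) k (by omega)) fun i hi k hk => ?_
      refine (hge i (by omega) k (by omega)).imp_right ?_
      rintro ⟨i', hi', j, hj, hij, h1⟩
      obtain rfl : i' = i := by simpa [mergeLabel] using hij
      exact ⟨j, by omega, h1⟩
    · rw [h.count x hxU y hyU, distCount_eq_zero hxy] at hd
      refine h.opt.twin hγ hxU hyU hxy (fun u hu => ?_) hd hA'
        (fun i hi j hj k hk => hle i (by omega) j (by omega) k (by omega)) fun p hp k hk => ?_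
      · rw [closedAdj_comm, hd u hu, closedAdj_comm]
      · refine (hge p (by omega) k (by omega)).imp_right ?_
        rintro ⟨i, hi, j, hj, hij, h1⟩
        exact ⟨i, by omega, j, by omega, hij, h1⟩

end Invariant

/-- The machine compares entries with values 0 and 1; this translates the comparison into the
negation of the condition counted by `distCount`. -/
theorem ite_eq_ite_iff {p q r : Prop} [Decidable p] [Decidable q] [Decidable r] :
    ((if p then 1 else 0 : ℕ) = if r then 0 else if q then 1 else 0) ↔ (p ↔ (¬ r ∧ q)) := by
  by_cases p <;> by_cases q <;> by_cases r <;> simp [*]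

/-! ### Correctness and cost of an elimination step -/

/-- One elimination step. -/
def eliminate : Program :=
  .seq search <|
  .seq (block [.move 11 30, .move 12 31, .move 13 32, .mul 20 11 0, .add 20 20 11, .const 21 0,
    .store 20 21]) <|
  .seq (updateCounts .sub) merge

theorem runs_eliminate {n W : ℕ} {G : SimpleGraph (Fin n)} (hG : IsBlockGraph G) {U : Finset ℕ}
    {s : State} (hs : Consts n s) (hW : 2 * (n * n) + 100 * n + 100 ≤ W)
    (h : Invariant G U s.mem) (hU : U.Nonempty) :
    Runs W eliminate s fun s' t => t ≤ n * (n * 43 + 8) + 6000 ∧ (∀ q < 11, s'.reg q = s.reg q) ∧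
      ∃ x ∈ U, Invariant G (U.erase x) s'.mem := by
  classical
  refine Runs.seq ((runs_search hs hW (fun x hx y hy => h.adj_le hx hy) h.count_le
    (h.exists_candidate hG hU)).mono ?_)
  rintro ⟨r1, m1⟩ t1 ⟨ht1, hr1, hm, hF⟩
  obtain rfl : m1 = s.mem := hm
  simp only at hF hr1
  have hxU := h.mem_of_found hF
  have hx := h.subset _ hxU
  generalize hx0 : r1 30 = x at *
  generalize hy0 : r1 31 = y at *
  generalize hd0 : r1 32 = d at *
  have hy : y ≤ n := by
    obtain ⟨-, h | h⟩ := hF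
    · omega
    · omega
  have hd : d ≤ 2 := by
    obtain ⟨-, h | ⟨-, -, -, h⟩⟩ := hF <;> omega
  have c0 := (hr1 0 (by norm_num)).trans hs.r0
  have p1 := mul_add_le hx
  refine Runs.seq (Runs.mono (Post := fun s1 t1 => t1 = 7 ∧
    s1.mem = Function.update s.mem (addrM n x x) 0 ∧ (∀ q < 11, s1.reg q = s.reg q) ∧
    s1.reg 11 = x ∧ s1.reg 12 = y ∧ s1.reg 13 = d) (Runs.block ?_ ?_) ?_)
  · simp [BlockOk, Instr.value, Instr.apply, c0, hx0, hy0, hd0]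
    omega
  · simp [runBlock, Instr.value, Instr.apply, c0, hx0, hy0, hd0, addrM]
    intro q hq
    simp (disch := omega) only [Function.update_of_ne]
    exact hr1 q (by omega)
  rintro ⟨r2, m2⟩ t2 ⟨rfl, hm, hr2, k11, k12, k13⟩
  simp only at hm hr2 k11 k12 k13
  have hc2 : Consts n ⟨r2, m2⟩ := hs.congr fun q hq => hr2 q (by omega)
  have hM2 : ∀ u < n, ∀ v < n, m2 (addrM n u v) =
      if u = x ∧ v = x then 0 else s.mem (addrM n u v) := fun u hu v hv => by
    rw [hm, update_addrM_addrM hx hv]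
  have hQ2 : ∀ u v, m2 (addrQ n u v) = s.mem (addrQ n u v) := fun u v => by
    rw [hm, update_addrM_addrQ hx hx]
  have hA2 : ∀ u i j, m2 (addrA n u i j) = s.mem (addrA n u i j) := fun u i j => by
    rw [hm, update_addrM_addrA hx hx]
  -- The diagonal flag of `x` is already cleared. This can spoil only counts involving `x`, which
  -- leave the invariant; the other vertices meet `x` off the diagonal.
  refine Runs.seq ((runs_updateCounts hc2 hW hx k11 (f := fun a b => a - b)
    (fun q => by omega) (fun _ _ _ _ => rfl) (fun _ _ _ _ => rfl) (fun u hu v hv => ?_)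
    (fun u hu v hv => (hQ2 u v).trans_le (h.count_le u hu v hv))).mono ?_)
  · change m2 _ ≤ 1
    rw [hM2 u hu v hv]
    split_ifs
    · norm_num
    · exact h.adj_le hu hv
  rintro s3 t3 ⟨ht3, hr3, hM3, hA3, hQ3⟩
  have hA3' : ∀ u i j, s3.mem (addrA n u i j) = s.mem (addrA n u i j) := fun u i j =>
    (hA3 u i j).trans (hA2 u i j)
  have hc3 : Consts n s3 := hc2.congr fun q hq => hr3 q (by omega)
  refine (runs_merge hc3 hW hx hy ((hr3 11 (by norm_num)).trans k11)
    ((hr3 12 (by norm_num)).trans k12) ((hr3 13 (by norm_num)).trans k13)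
    (fun u hu i hi j hj => (hA3' u i j).trans_le (h.table_le u hu i hi j hj))).mono ?_
  rintro s4 t4 ⟨ht4, hr4, hM4, hQ4, hA4, hB4, hle4, hge4⟩
  have hcost : ∀ i j k, mergeCost n s3.mem x y d i j k = mergeCost n s.mem x y d i j k :=
    fun i j k => by rw [mergeCost, mergeCost, hA3', hA3']
  simp only [hcost] at hle4 hge4
  have hA4' : ∀ u ≤ n, u ≠ y → ∀ i < 4, ∀ j < 4,
      s4.mem (addrA n u i j) = s.mem (addrA n u i j) := fun u hu huy i hi j hj =>
    (hA4 u hu huy i hi j hj).trans (hA3' u i j)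
  obtain ⟨hdum, hopt⟩ := h.eliminate hF hA4' hB4 hle4 hge4
  refine ⟨?_, fun q hq => (hr4 q (by omega)).trans ((hr3 q (by omega)).trans (hr2 q hq)),
    x, hxU, ?_⟩
  · have e1 : n * (n * 43 + 8) = n * (n * 25 + 4) + n * (n * 18 + 4) := by ring
    omega
  refine ⟨fun u hu => h.subset u (Finset.mem_of_mem_erase hu), fun u hu v hv => ?_,
    fun u hu v hv => ?_, fun u hu v hv => ?_, fun u hu i hi j hj => ?_, hdum, hopt⟩
  · refine (hM4 u hu v hv).trans ((hM3 u hu v hv).trans ((hM2 u hu v hv).trans ?_))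
    rw [h.adj u hu v hv]
    by_cases huv : u = v
    · subst huv
      by_cases hux : u = x <;> simp [hux]
    · have : ¬ (u = x ∧ v = x) := fun h => huv (h.1.trans h.2.symm)
      simp [this, huv]
  · rw [Finset.mem_erase] at hu hv
    have hun := h.subset u hu.2
    have hvn := h.subset v hv.2
    have h1 : ∀ w ∈ U, w ≠ x → m2 (addrM n w x) = if closedAdj G w x then 1 else 0 := by
      intro w hw hwx
      rw [hM2 w (h.subset w hw) x hx, if_neg (by tauto), h.adj w (h.subset w hw) x hx]
      simp [hwx]
    rw [hQ4 u hun v hvn, hQ3 u hun v hvn]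
    simp only
    rw [h1 u hu.2 hu.1, h1 v hv.2 hv.1, hQ2, h.count u hu.2 v hv.2, distCount_erase hxU]
    have h2 := ite_eq_ite_iff (p := closedAdj G u x) (q := closedAdj G v x) (r := u = v)
    by_cases hif : closedAdj G u x ↔ (u ≠ v ∧ closedAdj G v x)
    · rw [if_pos (h2.2 hif), if_pos hif, add_zero]
    · rw [if_neg (mt h2.1 hif), if_neg hif, Nat.add_sub_cancel]
  -- Truncated subtraction keeps the bound even for the meaningless counts.
  · rw [hQ4 u hu v hv, hQ3 u hu v hv]
    have := h.count_le u hu v hv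
    rw [← hQ2] at this
    split_ifs
    all_goals first | exact this | exact (Nat.sub_le _ _).trans this
  · by_cases huy : u = y
    · subst huy
      exact hB4 i hi j hj
    · rw [hA4' u hu huy i hi j hj]
      exact h.table_le u hu i hi j hj

/-! ### The complete program -/

/-- The program that computes `gammaR3` on block graphs. -/
def gammaR3Program : Program :=
  .seq setConsts <|
  .seq initTables <|
  .seq (forLoop 11 0 (updateCounts .add)) <|
  .seq (forLoop 10 0 eliminate) <|
  block [.mul 20 0 8, .add 20 20 3, .load 0 20]

theorem input_mem_of_le {n a : ℕ} (G : SimpleGraph (Fin n)) (ha : n * n ≤ a) :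
    (input G).mem a = 0 := by
  unfold input
  refine if_neg ?_
  rintro ⟨u, v, -, h⟩
  have := mul_add_le u.2
  omega

open Classical in
theorem input_mem_addrM {n x y : ℕ} (G : SimpleGraph (Fin n)) (hx : x < n) (hy : y < n)
    (hxy : x ≠ y) : (input G).mem (addrM n x y) = if closedAdj G x y then 1 else 0 := by
  unfold input
  refine if_congr ?_ rfl rfl
  lift x to Fin n using hx
  lift y to Fin n using hy
  have hne : x ≠ y := fun h => hxy (by rw [h])
  rw [closedAdj_val, or_iff_right hne]
  constructor
  · rintro ⟨u, v, huv, h⟩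
    obtain ⟨h1, h2⟩ := (addrM_inj y.2 v.2).1 h
    rwa [Fin.ext h1, Fin.ext h2]
  · exact fun h => ⟨x, y, h, rfl⟩

open Classical in
theorem runs_gammaR3Program {n W : ℕ} {G : SimpleGraph (Fin n)} (hG : IsBlockGraph G)
    (hW : 2 * (n * n) + 100 * n + 100 ≤ W) :
    Runs W gammaR3Program (input G) fun s t => s.reg 0 = gammaR3 G ∧
      t ≤ 20000 * n ^ 3 + 20000 := by
  refine Runs.seq ((runs_setConsts (n := n) (by simp [input]) hW).mono ?_)
  rintro s1 t1 ⟨ht1, hm1, hc1⟩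
  refine Runs.seq ((runs_initTables hc1 hW).mono ?_)
  rintro s2 t2 ⟨ht2, hr2, hM2, hQ2, hA2, hA2'⟩
  have hc2 : Consts n s2 := hc1.congr hr2
  rw [hm1] at hM2 hQ2 hA2'
  have hM2' : ∀ x < n, ∀ y < n, s2.mem (addrM n x y) = if closedAdj G x y then 1 else 0 := by
    intro x hx y hy
    rw [hM2 x hx y hy]
    by_cases hxy : x = y
    · rw [if_pos hxy, if_pos (show closedAdj G x y from Or.inl hxy)]
    · rw [if_neg hxy, input_mem_addrM G hx hy hxy]
  -- The counts start at zero for the empty set, and the vertices are inserted one by one.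
  refine Runs.seq ((Runs.of_forLoop (T := n * (n * 18 + 4) + 2) (N := n) (fun z s' =>
    (∀ x < n, ∀ y < n, s'.mem (addrM n x y) = s2.mem (addrM n x y)) ∧
    (∀ u i j, s'.mem (addrA n u i j) = s2.mem (addrA n u i j)) ∧
    (∀ x < n, ∀ y < n, s'.mem (addrQ n x y) = distCount (closedAdj G) (Finset.range z) x y))
    (by norm_num) (by norm_num) hc2.r0 hc2.r1 (by omega) (fun _ _ _ h => h) ?_ ?_).mono ?_)
  · refine ⟨fun _ _ _ _ => rfl, fun _ _ _ => rfl, fun x hx y hy => ?_⟩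
    rw [hQ2 x hx y hy, input_mem_of_le G (by unfold addrQ; omega)]
    simp [distCount]
  · rintro z hz s3 hr3 h11 ⟨h1, h2, h3⟩
    have hc3 : Consts n s3 := hc2.congr fun q hq => hr3 q (by omega)
    refine (runs_updateCounts hc3 hW hz h11 (f := fun a b => a + b) (fun q => le_rfl)
      (fun _ _ _ _ => rfl) (fun _ _ _ _ => rfl) (fun x hx y hy => ?_)
      (fun x hx y hy => ?_)).mono ?_
    · rw [h1 x hx y hy, hM2' x hx y hy]
      split_ifs <;> norm_num
    · rw [h3 x hx y hy]
      have := distCount_le_card (closedAdj G) (Finset.range z) x y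
      rw [Finset.card_range] at this
      omega
    · rintro s4 t4 ⟨ht4, hr4, hM4, hA4, hQ4⟩
      refine ⟨ht4, fun q hq => hr4 q (by omega),
        fun x hx y hy => (hM4 x hx y hy).trans (h1 x hx y hy),
        fun u i j => (hA4 u i j).trans (h2 u i j), fun x hx y hy => ?_⟩
      have he : (Finset.range (z + 1)).erase z = Finset.range z := by
        rw [Finset.range_add_one, Finset.erase_insert Finset.notMem_range_self]
      rw [hQ4 x hx y hy, h1 x hx z hz, h1 y hy z hz, hM2' x hx z hz, hM2' y hy z hz, h3 x hx y hy,
        distCount_erase (Finset.self_mem_range_succ z), he]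
      have h4 := ite_eq_ite_iff (p := closedAdj G x z) (q := closedAdj G y z) (r := x = y)
      by_cases hif : closedAdj G x z ↔ (x ≠ y ∧ closedAdj G y z)
      · rw [if_pos (h4.2 hif), if_pos hif, add_zero]
      · rw [if_neg (mt h4.1 hif), if_neg hif]
  rintro s3 t3 ⟨ht3, hr3, hM3, hA3, hQ3⟩
  have hc3 : Consts n s3 := hc2.congr fun q hq => hr3 q (by omega)
  have hdum : ∀ i < 4, ∀ j < 4, s3.mem (addrA n n i j) = 0 := fun i hi j hj => by
    rw [hA3, hA2' i hi j hj, input_mem_of_le G (by unfold addrA; omega)]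
  have hinv : Invariant G (Finset.range n) s3.mem := by
    refine ⟨fun x hx => Finset.mem_range.1 hx, fun x hx y hy => ?_, fun x hx y hy =>
      hQ3 x (Finset.mem_range.1 hx) y (Finset.mem_range.1 hy), fun x hx y hy => ?_,
      fun u hu i hi j hj => ?_, fun k hk => ?_, ?_⟩
    · rw [hM3 x hx y hy, hM2' x hx y hy]
      refine if_congr ?_ rfl rfl
      by_cases hxy : x = y
      · exact iff_of_true (Or.inl hxy) (Or.inl ⟨hxy, Finset.mem_range.2 hx⟩)
      · simp [hxy]
    · rw [hQ3 x hx y hy]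
      have := distCount_le_card (closedAdj G) (Finset.range n) x y
      rwa [Finset.card_range] at this
    · rcases hu.lt_or_eq with hu | rfl
      · rw [hA3, hA2 u hu i hi j hj]
        unfold initialTable
        split_ifs <;> omega
      · rw [hdum i hi j hj]
        omega
    · rw [hdum 0 (by norm_num) k hk, hdum 0 (by norm_num) 0 (by norm_num)]
    · rw [hdum 0 (by norm_num) 0 (by norm_num)]
      exact isOptimum_gammaR3 G fun u hu p hp q hq => by
        rw [hA3, hA2 u hu p (by omega) q (by omega)]
  -- The order of elimination depends on the searches, so only the size of `U` is tied to the
  -- counter.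
  refine Runs.seq ((Runs.of_forLoop (T := n * (n * 43 + 8) + 6000) (N := n) (fun i s' =>
    ∃ U : Finset ℕ, U.card + i = n ∧ Invariant G U s'.mem)
    (by norm_num) (by norm_num) hc3.r0 hc3.r1 (by omega) (fun _ _ _ h => h)
    ⟨Finset.range n, by simp, hinv⟩ ?_).mono ?_)
  · rintro i hi s4 hr4 h10 ⟨U, hU, hI⟩
    refine (runs_eliminate hG (hc3.congr hr4) hW hI (Finset.card_pos.1 (by omega))).mono ?_
    rintro s5 t5 ⟨ht5, hr5, x, hx, hI5⟩
    refine ⟨ht5, hr5, U.erase x, ?_, hI5⟩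
    have := Finset.card_erase_add_one hx
    omega
  rintro s4 t4 ⟨ht4, hr4, U, hU, hI⟩
  obtain rfl : U = ∅ := Finset.card_eq_zero.1 (by omega)
  have hc4 : Consts n s4 := hc3.congr hr4
  -- With no vertices left the table cost is an empty sum, and the constant is the optimum.
  have hγ : s4.mem (addrA n n 0 0) = gammaR3 G := by
    obtain ⟨⟨b, -, h1⟩, h2⟩ := hI.opt
    have h3 := h2 (fun _ => 0) (fun _ => by norm_num)
    simp only [tableCost, Finset.sum_empty, add_zero] at h1 h3
    omega
  have hle := hI.table_le n le_rfl 0 (by norm_num) 0 (by norm_num)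
  unfold addrA at hγ hle
  simp only [zero_mul, add_zero] at hγ hle
  refine Runs.block ?_ ?_
  · simp [BlockOk, Instr.value, Instr.apply, hc4.r0, hc4.r8, hc4.r3]
    omega
  · simp [runBlock, Instr.value, Instr.apply, hc4.r0, hc4.r8, hc4.r3, hγ]
    have e1 : n ≤ n ^ 3 := Nat.le_self_pow (by norm_num) n
    have e2 : n ^ 2 ≤ n ^ 3 := by
      rcases Nat.eq_zero_or_pos n with rfl | hn
      · norm_num
      · exact Nat.pow_le_pow_right hn (by norm_num)
    have e3 : n * (n * (n * 18 + 4) + 2 + 2) = 18 * n ^ 3 + 4 * n ^ 2 + 4 * n := by ring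
    have e4 : n * (n * (n * 43 + 8) + 6000 + 2) = 43 * n ^ 3 + 8 * n ^ 2 + 6002 * n := by ring
    omega

end RAM

theorem theorem4 :
    ∃ (P : RAM.Program) (C k : ℕ), ∀ (n : ℕ) (G : SimpleGraph (Fin n)), IsBlockGraph G →
      ∃ (s : RAM.State) (t : ℕ),
        RAM.Exec ((n + 2) ^ k) P (RAM.input G) s t ∧
        s.reg 0 = gammaR3 G ∧
        t ≤ C * n ^ 3 + C := by
  -- The word size has to reach `2 * (n * n) + 100 * n + 100`, which is at most `2 ^ 6 * (n + 2) ^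
  -- 2`. As `n + 2 ≥ 2`, six more powers absorb the factor, whence the exponent 8.
  refine ⟨RAM.gammaR3Program, 20000, 8, fun n G hG => RAM.runs_gammaR3Program hG ?_⟩
  have h1 : 2 ^ 6 ≤ (n + 2) ^ 6 := Nat.pow_le_pow_left (by omega) 6
  calc 2 * (n * n) + 100 * n + 100 ≤ 2 ^ 6 * (n + 2) ^ 2 := by nlinarith
    _ ≤ (n + 2) ^ 6 * (n + 2) ^ 2 := Nat.mul_le_mul_right _ h1
    _ = (n + 2) ^ 8 := by ring
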